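/- A binary linear code $C$ of length $n$ is a subspace of $\mathbb F_2^n$, with dual $C^\perp$ for the standard inner product; two codes are equivalent if they agree up to a permutation of the coordinates. $C$ is of Type I if $C=C^\perp$ and not all its weights are divisible by $4$; it is even formally self-dual if all its weights are even and $C$ and $C^\perp$ have the same weight distribution; a code of either kind is near-extremal if its minimum distance is $2\lfloor n/8\rfloor$. For $w>0$ let $C_w$ be the collection of supports of the codewords of weight $w$ of $C$, viewed as blocks on the $n$ coordinates. A $t$-$(v,k,\lambda)$ design ($t\le k\le v$) is a collection of $k$-subsets of a $v$-set, repeated blocks allowed, such that every $t$-subset lies in exactly $\lambda$ of them, counted with multiplicity (we allow $\lambda=0$, the empty collection); a $t$-design is a $t$-$(v,k,\lambda)$ design for some $v,k,\lambda$. Let $\delta(C)$ (respectively $s(C)$) be the largest $t$ such that $C_w$ is a $t$-design for all (respectively for at least one) of the weights $w$ with $0<w<n$ and $C_w\neq\emptyset$. (1) Up to equivalence there is exactly one Type I $[16,8,4]$ code. For a near-extremal Type I code $C$ of length $n\equiv 0\pmod 8$, $\delta(C)<s(C)$ holds if and only if $C$ is equivalent to this code. In that case $C_6$ is a $2$-$(16,6,8)$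 design, and $C_{10}$ is its complementary design, i.e. the blocks of $C_{10}$ are the complements of those of $C_6$. (2) Let $C'$ be a near-extremal even formally self-dual code of length $16$. Then $C'_6\cup C'^{\perp}_6$ and $C'_{10}\cup C'^{\perp}_{10}$ are $2$-designs, where the union is a union of multisets with multiplicities added (a block that occurs in both collections is counted twice). (3) Let $C''$ be a near-extremal even formally self-dual code of length $64$, if one exists. Then $C''_{28}\cup C''^{\perp}_{28}$ and $C''_{36}\cup C''^{\perp}_{36}$ are $2$-designs, with the same meaning of the union. -/

import Mathlib

namespace SupportDesign

open scoped Classical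

/-- A binary linear code of length `n`: a subspace of `𝔽₂ⁿ`. -/
abbrev Code (n : ℕ) := Submodule (ZMod 2) (Fin n → ZMod 2)

/-- The dual code with respect to the standard inner product `∑ i, x i * y i`. -/
def dual {n : ℕ} (C : Code n) : Code n where
  carrier := {y | ∀ x ∈ C, ∑ i, x i * y i = 0}
  add_mem' := by
    intro a b ha hb x hx
    simp only [Pi.add_apply, mul_add, Finset.sum_add_distrib, ha x hx, hb x hx, add_zero]
  zero_mem' := by
    intro x _
    simp
  smul_mem' := by
    intro c a ha x hx
    simp only [Pi.smul_apply, smul_eq_mul, mul_left_comm, ← Finset.mul_sum, ha x hx, mul_zero]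

/-- `d` is the minimum distance of `C` (the code has a nonzero word). -/
def HasMinDist {n : ℕ} (C : Code n) (d : ℕ) : Prop :=
  IsLeast {w | ∃ x ∈ C, x ≠ 0 ∧ hammingNorm x = w} d

/-- `C` is an `[n, k, d]` code. -/
def HasParams {n : ℕ} (C : Code n) (k d : ℕ) : Prop :=
  Module.finrank (ZMod 2) C = k ∧ HasMinDist C d

/-- A Type I code: self-dual and not doubly even. -/
def IsTypeI {n : ℕ} (C : Code n) : Prop :=
  dual C = C ∧ ¬ ∀ x ∈ C, 4 ∣ hammingNorm x

/-- The set of codewords of weight `w`. -/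
noncomputable def wordsOfWeight {n : ℕ} (C : Code n) (w : ℕ) : Finset (Fin n → ZMod 2) :=
  Finset.univ.filter fun x => x ∈ C ∧ hammingNorm x = w

/-- An even code with the same weight distribution as its dual code. -/
def IsEvenFormallySelfDual {n : ℕ} (C : Code n) : Prop :=
  (∀ x ∈ C, 2 ∣ hammingNorm x) ∧
    ∀ w, (wordsOfWeight C w).card = (wordsOfWeight (dual C) w).card

/-- The minimum distance is `2 ⌊n / 8⌋`. -/
def IsNearExtremal {n : ℕ} (C : Code n) : Prop :=
  HasMinDist C (2 * (n / 8))

/-- Equivalence of binary codes: equality up to a bijection of the coordinates. -/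
def IsEquivalent {n m : ℕ} (C : Code n) (D : Code m) : Prop :=
  ∃ e : Fin n ≃ Fin m, ∀ x : Fin m → ZMod 2, x ∈ D ↔ x ∘ e ∈ C

/-- The support of a vector. -/
def supp {n : ℕ} (x : Fin n → ZMod 2) : Finset (Fin n) :=
  Finset.univ.filter fun i => x i ≠ 0

/-- The blocks of the support design `C_w`. -/
noncomputable def blocks {n : ℕ} (C : Code n) (w : ℕ) : Multiset (Finset (Fin n)) :=
  (wordsOfWeight C w).val.map supp

/-- The collection `B` of blocks (repeated blocks allowed) is a `t`-`(v, k, l)` design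
on the point set `X`. -/
def IsDesign {X : Type*} [Fintype X] (B : Multiset (Finset X)) (t v k l : ℕ) : Prop :=
  Fintype.card X = v ∧ t ≤ k ∧ k ≤ v ∧ (∀ b ∈ B, b.card = k) ∧
    ∀ T : Finset X, T.card = t → B.countP (fun b => T ⊆ b) = l

/-- The weights `w` for which `C_w` is a nontrivial block collection: `0 < w < n`
and there is a codeword of weight `w`. -/
def properWeights {n : ℕ} (C : Code n) : Set ℕ :=
  {w | 0 < w ∧ w < n ∧ ∃ x ∈ C, hammingNorm x = w}

/-- The support design `C_w` is a `t`-design. -/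
def IsSupportDesign {n : ℕ} (C : Code n) (w t : ℕ) : Prop :=
  ∃ l, IsDesign (blocks C w) t n w l

/-- `δ(C)`: the largest `t` such that all `C_w` are `t`-designs. -/
noncomputable def delta {n : ℕ} (C : Code n) : ℕ :=
  sSup {t | ∀ w ∈ properWeights C, IsSupportDesign C w t}

/-- `s(C)`: the largest `t` such that some `C_w` is a `t`-design. -/
noncomputable def sMax {n : ℕ} (C : Code n) : ℕ :=
  sSup {t | ∃ w ∈ properWeights C, IsSupportDesign C w t}

theorem isSupportDesign_zero {n : ℕ} (C : Code n) {w : ℕ} (hw : w ∈ properWeights C) :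
    IsSupportDesign C w 0 := by
  refine ⟨(blocks C w).card, by simp, Nat.zero_le _, hw.2.1.le, ?_, ?_⟩
  · intro b hb
    obtain ⟨x, hx, rfl⟩ := Multiset.mem_map.1 hb
    have hx' : x ∈ wordsOfWeight C w := hx
    exact (Finset.mem_filter.1 hx').2.2
  · intro T hT
    rw [Finset.card_eq_zero.1 hT]
    simp

/-- As soon as there is a proper weight, the supremum defining `δ(C)` is a maximum. -/
theorem delta_isGreatest {n : ℕ} (C : Code n) (h : (properWeights C).Nonempty) :
    IsGreatest {t | ∀ w ∈ properWeights C, IsSupportDesign C w t} (delta C) := by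
  obtain ⟨w, hw⟩ := h
  have hb : BddAbove {t | ∀ w ∈ properWeights C, IsSupportDesign C w t} :=
    ⟨w, fun t ht => (ht w hw).choose_spec.2.1⟩
  exact ⟨Nat.sSup_mem ⟨0, fun w hw => isSupportDesign_zero C hw⟩ hb, fun t ht => le_csSup hb ht⟩

/-- As soon as there is a proper weight, the supremum defining `s(C)` is a maximum. -/
theorem sMax_isGreatest {n : ℕ} (C : Code n) (h : (properWeights C).Nonempty) :
    IsGreatest {t | ∃ w ∈ properWeights C, IsSupportDesign C w t} (sMax C) := by
  obtain ⟨w, hw⟩ := h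
  have hb : BddAbove {t | ∃ w ∈ properWeights C, IsSupportDesign C w t} :=
    ⟨n, fun t ⟨_, hw, ht⟩ => ht.choose_spec.2.1.trans hw.2.1.le⟩
  exact ⟨Nat.sSup_mem ⟨0, w, hw, isSupportDesign_zero C hw⟩ hb, fun t ht => le_csSup hb ht⟩

end SupportDesign

namespace SupportDesign
open scoped Classical
open Polynomial

/-! Let the length be 8m. A collection of blocks of one size is a 2-design once the harmonic
functions bit i - bit j (degree 1) and (bit i - bit j)(bit k - bit l) (degree 2) sum to zero over it
(`isDesign_two`). Poisson summation gives the weight enumerator twisted by such a function of degree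
e a MacWilliams identity with the extra factor (-2y/(1-y²))^e. Adding the twisted enumerators of a
code and its dual produces one polynomial Z carried to itself. Near-extremality and the all-one word
confine its exponents to [2m, 6m], so `exists_factor` gives Z = X^(2m) (1-X²)^(2m-e) Q with deg Q ≤
2e. The functional equation leaves Q = 0 for e = 1 and Q = α(1+X²)² for e = 2. So every union is a
1-design, and it is a 2-design at each weight where `harmonicTwo m` has coefficient zero: 6 and 10
for m = 2, 28 and 36 for m = 8. This is (2) and (3).

For (1), the case m = 2 follows in the same way: C_6 is a 2-design and C_4 is not, by a divisibility
count. For m = 1, 3, 4 no relevant coefficient of `harmonicTwo m` vanishes, so a single 2-design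
would make C_(2m) one, which counting excludes; hence δ = s. For m ≥ 5 there is no code
(`not_isTypeI`): Lagrange inversion makes the last Gleason coefficient too negative for the shadow,
which has at most one vector of weight four.

Uniqueness at length 16 is read off from the twelve words of weight four. Three pass through each
point and form a sunflower around a pair, so the coordinates split into two blocks of four pairs
(`exists_two_components`). One glue word for each block (`exists_glue`) labels the coordinates, and
D contains the generators of `typeISixteen` in these labels. -/

/-- The finite set of codewords. -/
noncomputable def words {n : ℕ} (C : Code n) : Finset (Fin n → ZMod 2) :=
  Finset.univ.filter fun x => x ∈ C

@[simp] theorem mem_words {n : ℕ} {C : Code n} {x : Fin n → ZMod 2} : x ∈ words C ↔ x ∈ C := by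
  simp [words]

theorem mem_wordsOfWeight {n : ℕ} {C : Code n} {w : ℕ} {x : Fin n → ZMod 2} :
    x ∈ wordsOfWeight C w ↔ x ∈ C ∧ hammingNorm x = w := by
  simp [wordsOfWeight]

theorem mem_dual {n : ℕ} {C : Code n} {y : Fin n → ZMod 2} :
    y ∈ dual C ↔ ∀ x ∈ C, ∑ i, x i * y i = 0 := Iff.rfl

/-! ### Characters, Poisson summation and MacWilliams identities. -/

/-- The nontrivial additive character of `𝔽₂`. -/
noncomputable def sgn (a : ZMod 2) : ℝ := if a = 0 then 1 else -1

/-- The indicator of a nonzero element of `𝔽₂`. -/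
noncomputable def bit (a : ZMod 2) : ℝ := if a = 0 then 0 else 1

theorem zmod_two_cases (a : ZMod 2) : a = 0 ∨ a = 1 := by
  revert a; decide

@[simp] theorem sgn_zero : sgn 0 = 1 := by simp [sgn]
@[simp] theorem sgn_one : sgn 1 = -1 := by simp [sgn]
@[simp] theorem bit_zero : bit 0 = 0 := by simp [bit]
@[simp] theorem bit_one : bit 1 = 1 := by simp [bit]

theorem sgn_add (a b : ZMod 2) : sgn (a + b) = sgn a * sgn b := by
  have h : (1 : ZMod 2) + 1 = 0 := by decide
  rcases zmod_two_cases a with rfl | rfl <;> rcases zmod_two_cases b with rfl | rfl <;> simp [h]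

theorem sgn_sum {ι : Type*} (s : Finset ι) (f : ι → ZMod 2) :
    sgn (∑ i ∈ s, f i) = ∏ i ∈ s, sgn (f i) := by
  induction s using Finset.induction_on with
  | empty => simp
  | insert a s ha ih => rw [Finset.sum_insert ha, Finset.prod_insert ha, sgn_add, ih]

/-- A sum of a nontrivial `±1`-valued multiplicative function over a code vanishes. -/
theorem sum_words_eq_zero {n : ℕ} (C : Code n) (χ : (Fin n → ZMod 2) → ℝ) {x₀ : Fin n → ZMod 2}
    (hx₀ : x₀ ∈ C) (h : ∀ x ∈ C, χ (x + x₀) = - χ x) : ∑ x ∈ words C, χ x = 0 := by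
  have key : ∑ x ∈ words C, χ x = ∑ x ∈ words C, - χ x := by
    refine Finset.sum_bij' (fun x _ => x + x₀) (fun x _ => x - x₀) ?_ ?_ ?_ ?_ ?_
    · intro x hx; exact mem_words.2 (C.add_mem (mem_words.1 hx) hx₀)
    · intro x hx; exact mem_words.2 (C.sub_mem (mem_words.1 hx) hx₀)
    · intro x _; simp
    · intro x _; simp
    · intro x hx; rw [h x (mem_words.1 hx), neg_neg]
  rw [Finset.sum_neg_distrib] at key
  linarith

theorem sum_sgn {n : ℕ} (C : Code n) (y : Fin n → ZMod 2) :
    ∑ x ∈ words C, sgn (∑ i, x i * y i) = if y ∈ dual C then ((words C).card : ℝ) else 0 := by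
  split_ifs with h
  · rw [Finset.sum_congr rfl (g := fun _ => (1 : ℝ))]
    · simp
    · intro x hx
      rw [mem_dual.1 h x (mem_words.1 hx), sgn_zero]
  · rw [mem_dual] at h
    push Not at h
    obtain ⟨x₀, hx₀, h⟩ := h
    refine sum_words_eq_zero C _ hx₀ fun x _ => ?_
    simp only [Pi.add_apply, add_mul, Finset.sum_add_distrib]
    rw [sgn_add, (zmod_two_cases _).resolve_left h]
    simp

theorem prod_add_sgn {n : ℕ} (f : Fin n → ZMod 2 → ℝ) (x : Fin n → ZMod 2) :
    ∏ i, (f i 0 + sgn (x i) * f i 1) =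
      ∑ y : Fin n → ZMod 2, sgn (∑ i, x i * y i) * ∏ i, f i (y i) := by
  have h2 : ∀ i, f i 0 + sgn (x i) * f i 1 = ∑ a : ZMod 2, sgn (x i * a) * f i a := by
    intro i
    have : (Finset.univ : Finset (ZMod 2)) = {0, 1} := by decide
    rw [this, Finset.sum_pair (by decide)]
    simp
  simp_rw [h2]
  rw [Finset.prod_univ_sum]
  simp only [Fintype.piFinset_univ, Finset.prod_mul_distrib, sgn_sum]

/-- The Poisson summation formula for functions of product form. -/
theorem poisson {n : ℕ} (C : Code n) (f : Fin n → ZMod 2 → ℝ) :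
    ∑ x ∈ words C, ∏ i, (f i 0 + sgn (x i) * f i 1) =
      (words C).card * ∑ y ∈ words (dual C), ∏ i, f i (y i) := by
  simp_rw [prod_add_sgn]
  rw [Finset.sum_comm]
  simp_rw [← Finset.sum_mul, sum_sgn, ite_mul, zero_mul]
  rw [← Finset.sum_filter, Finset.mul_sum]
  rfl

theorem prod_ite_eq_pow {n : ℕ} (x : Fin n → ZMod 2) (a b : ℝ) :
    ∏ i, (if x i = 0 then a else b) = a ^ (n - hammingNorm x) * b ^ hammingNorm x := by
  rw [Finset.prod_ite, Finset.prod_const, Finset.prod_const, hammingNorm]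
  congr 2
  have := Finset.card_filter_add_card_filter_not (s := (Finset.univ : Finset (Fin n)))
    (fun i => x i ≠ 0)
  simp only [Finset.card_univ, Fintype.card_fin, not_not] at this
  omega

theorem hammingNorm_le {n : ℕ} (x : Fin n → ZMod 2) : hammingNorm x ≤ n := by
  simpa using hammingNorm_le_card_fintype (x := x)

/-- The generating function of the weights of `C`, each word counted with the factor `g`. -/
noncomputable def enum {n : ℕ} (C : Code n) (g : (Fin n → ZMod 2) → ℝ) : ℝ[X] :=
  ∑ c ∈ words C, Polynomial.C (g c) * X ^ hammingNorm c

theorem eval_enum {n : ℕ} (C : Code n) (g : (Fin n → ZMod 2) → ℝ) (y : ℝ) :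
    (enum C g).eval y = ∑ c ∈ words C, g c * y ^ hammingNorm c := by
  simp [enum, eval_finsetSum]

theorem coeff_enum {n : ℕ} (C : Code n) (g : (Fin n → ZMod 2) → ℝ) (w : ℕ) :
    (enum C g).coeff w = ∑ c ∈ wordsOfWeight C w, g c := by
  simp only [enum, finsetSum_coeff, coeff_C_mul, coeff_X_pow, mul_ite, mul_one, mul_zero]
  rw [← Finset.sum_filter]
  congr 1
  ext x
  simp [mem_wordsOfWeight, eq_comm]

theorem enum_sub {n : ℕ} (C : Code n) (g h : (Fin n → ZMod 2) → ℝ) :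
    enum C (fun c => g c - h c) = enum C g - enum C h := by
  simp [enum, sub_mul, Finset.sum_sub_distrib]

theorem enum_add {n : ℕ} (C : Code n) (g h : (Fin n → ZMod 2) → ℝ) :
    enum C (fun c => g c + h c) = enum C g + enum C h := by
  simp [enum, add_mul, Finset.sum_add_distrib]

/-- The right-hand side of the MacWilliams identity as a value of the generating function. -/
theorem pow_mul_eval_enum {n : ℕ} (C : Code n) (g : (Fin n → ZMod 2) → ℝ) {y : ℝ}
    (hy : 1 + y ≠ 0) :
    (1 + y) ^ n * (enum C g).eval ((1 - y) / (1 + y)) =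
      ∑ c ∈ words C, g c * ((1 + y) ^ (n - hammingNorm c) * (1 - y) ^ hammingNorm c) := by
  rw [eval_enum, Finset.mul_sum]
  refine Finset.sum_congr rfl fun c _ => ?_
  have h : (1 + y) ^ n = (1 + y) ^ (n - hammingNorm c) * (1 + y) ^ hammingNorm c := by
    rw [← pow_add, Nat.sub_add_cancel (hammingNorm_le c)]
  rw [h, div_pow]
  field_simp

/-- The MacWilliams identity for the words containing a given set of coordinates. -/
theorem macWilliams_subset {n : ℕ} (C : Code n) (T : Finset (Fin n)) {y : ℝ}
    (h0 : 0 < y) (h1 : y < 1) :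
    (words C).card * (enum (dual C) fun c => ∏ i ∈ T, bit (c i)).eval y =
      (1 + y) ^ n * (enum C fun c => ∏ i ∈ T, (y / (1 + y) - 2 * y / (1 - y ^ 2) * bit (c i))).eval
        ((1 - y) / (1 + y)) := by
  have hp : 1 + y ≠ 0 := by positivity
  have hq : 1 - y ≠ 0 := by linarith
  have hr : 1 - y ^ 2 ≠ 0 := by nlinarith
  rw [pow_mul_eval_enum _ _ hp, eval_enum]
  have key := poisson C fun i a => (if i ∈ T then bit a else 1) * (if a = 0 then 1 else y)
  have e1 : ∀ c : Fin n → ZMod 2, (∏ i ∈ T, bit (c i)) * y ^ hammingNorm c =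
      ∏ i, (if i ∈ T then bit (c i) else 1) * (if c i = 0 then 1 else y) := by
    intro c
    rw [Finset.prod_mul_distrib, prod_ite_eq_pow]
    simp
  -- At a coordinate of T the transform is y or -y; divided by the weight factor 1+y or 1-y it
  -- becomes an affine function of `bit`.
  have e2 : ∀ c : Fin n → ZMod 2,
      (∏ i ∈ T, (y / (1 + y) - 2 * y / (1 - y ^ 2) * bit (c i))) *
        ((1 + y) ^ (n - hammingNorm c) * (1 - y) ^ hammingNorm c) =
      ∏ i, ((if i ∈ T then bit 0 else 1) * (if (0 : ZMod 2) = 0 then 1 else y) +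
        sgn (c i) * ((if i ∈ T then bit 1 else 1) * (if (1 : ZMod 2) = 0 then 1 else y))) := by
    intro c
    rw [← prod_ite_eq_pow, ← Finset.prod_ite_mem_eq, ← Finset.prod_mul_distrib]
    refine Finset.prod_congr rfl fun i _ => ?_
    by_cases hi : i ∈ T <;> rcases zmod_two_cases (c i) with h | h <;> simp [hi, h]
    · field_simp
    · field_simp
      ring
    · ring
  simp_rw [e1, e2]
  exact key.symm

theorem enum_const_mul {n : ℕ} (C : Code n) (a : ℝ) (g : (Fin n → ZMod 2) → ℝ) :
    enum C (fun c => a * g c) = Polynomial.C a * enum C g := by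
  simp [enum, Finset.mul_sum, mul_assoc]

theorem macWilliams {n : ℕ} (C : Code n) {y : ℝ} (h0 : 0 < y) (h1 : y < 1) :
    (words C).card * (enum (dual C) fun _ => 1).eval y =
      (1 + y) ^ n * (enum C fun _ => 1).eval ((1 - y) / (1 + y)) := by
  simpa using macWilliams_subset C ∅ h0 h1

/-- In the difference of the affine factors at i and j the constant y/(1+y) cancels, so bit i - bit
j reproduces itself up to the factor -2y/(1-y²). -/
theorem macWilliams_sub {n : ℕ} (C : Code n) (i j : Fin n) {y : ℝ} (h0 : 0 < y) (h1 : y < 1) :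
    (words C).card * (1 - y ^ 2) * (enum (dual C) fun c => bit (c i) - bit (c j)).eval y =
      -2 * y * (1 + y) ^ n *
        (enum C fun c => bit (c i) - bit (c j)).eval ((1 - y) / (1 + y)) := by
  have hr : 1 - y ^ 2 ≠ 0 := by nlinarith
  have hi := macWilliams_subset C {i} h0 h1
  have hj := macWilliams_subset C {j} h0 h1
  simp only [Finset.prod_singleton] at hi hj
  have e : enum C (fun c => bit (c i) - bit (c j)) =
      Polynomial.C (-((1 - y ^ 2) / (2 * y))) *
        (enum C (fun c => y / (1 + y) - 2 * y / (1 - y ^ 2) * bit (c i)) -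
         enum C (fun c => y / (1 + y) - 2 * y / (1 - y ^ 2) * bit (c j))) := by
    rw [← enum_sub, ← enum_const_mul]
    congr 1
    ext c
    field_simp
    ring
  rw [e, enum_sub, eval_mul, eval_sub, eval_sub, eval_C]
  have : (1 + y) ^ n * (-((1 - y ^ 2) / (2 * y)) *
      ((enum C (fun c => y / (1 + y) - 2 * y / (1 - y ^ 2) * bit (c i))).eval ((1 - y) / (1 + y)) -
       (enum C (fun c => y / (1 + y) - 2 * y / (1 - y ^ 2) * bit (c j))).eval
        ((1 - y) / (1 + y)))) =
      -((1 - y ^ 2) / (2 * y)) * ((words C).card * (enum (dual C) fun c => bit (c i)).eval y -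
        (words C).card * (enum (dual C) fun c => bit (c j)).eval y) := by
    rw [hi, hj]; ring
  rw [mul_assoc _ ((1 + y) ^ n), this]
  field_simp

/-- Expanding the product gives four instances of `macWilliams_subset`, whose index sets are genuine
pairs by the four inequalities; each of the two differences contributes a factor -2y/(1-y²). -/
theorem macWilliams_sub_mul_sub {n : ℕ} (C : Code n) {i j k l : Fin n} (hik : i ≠ k) (hil : i ≠ l)
    (hjk : j ≠ k) (hjl : j ≠ l) {y : ℝ} (h0 : 0 < y) (h1 : y < 1) :
    (words C).card * (1 - y ^ 2) ^ 2 *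
        (enum (dual C) fun c => (bit (c i) - bit (c j)) * (bit (c k) - bit (c l))).eval y =
      (-2 * y) ^ 2 * (1 + y) ^ n *
        (enum C fun c => (bit (c i) - bit (c j)) * (bit (c k) - bit (c l))).eval
          ((1 - y) / (1 + y)) := by
  have hr : 1 - y ^ 2 ≠ 0 := by nlinarith
  have Hik := macWilliams_subset C {i, k} h0 h1
  have Hil := macWilliams_subset C {i, l} h0 h1
  have Hjk := macWilliams_subset C {j, k} h0 h1
  have Hjl := macWilliams_subset C {j, l} h0 h1
  simp only [Finset.prod_pair hik, Finset.prod_pair hil, Finset.prod_pair hjk,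
    Finset.prod_pair hjl] at Hik Hil Hjk Hjl
  set τ : ZMod 2 → ℝ := fun a => y / (1 + y) - 2 * y / (1 - y ^ 2) * bit a with hτ
  have e : enum C (fun c => (bit (c i) - bit (c j)) * (bit (c k) - bit (c l))) =
      Polynomial.C (((1 - y ^ 2) / (2 * y)) ^ 2) *
        (enum C (fun c => τ (c i) * τ (c k)) - enum C (fun c => τ (c i) * τ (c l)) -
         enum C (fun c => τ (c j) * τ (c k)) + enum C (fun c => τ (c j) * τ (c l))) := by
    rw [← enum_sub, ← enum_sub, ← enum_add, ← enum_const_mul]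
    congr 1
    ext c
    simp only [hτ]
    field_simp
    ring
  have e' : enum (dual C) (fun c => (bit (c i) - bit (c j)) * (bit (c k) - bit (c l))) =
        enum (dual C) (fun c => bit (c i) * bit (c k)) -
         enum (dual C) (fun c => bit (c i) * bit (c l)) -
         enum (dual C) (fun c => bit (c j) * bit (c k)) +
         enum (dual C) (fun c => bit (c j) * bit (c l)) := by
    rw [← enum_sub, ← enum_sub, ← enum_add]
    congr 1
    ext c
    ring
  rw [e, e']
  simp only [eval_mul, eval_sub, eval_add, eval_C]
  have : ∀ a b c d : ℝ, (1 + y) ^ n * (a - b - c + d) =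
    (1 + y) ^ n * a - (1 + y) ^ n * b - (1 + y) ^ n * c + (1 + y) ^ n * d := by intros; ring
  rw [mul_assoc _ ((1 + y) ^ n), mul_left_comm ((1 + y) ^ n), this, ← Hik, ← Hil, ← Hjk, ← Hjl]
  field_simp

/-! ### Duality, parity and complements. -/

theorem card_words_mul_card_words_dual {n : ℕ} (C : Code n) :
    (words C).card * (words (dual C)).card = 2 ^ n := by
  -- For constant functions the left side is concentrated at the zero word, where it equals 2^n.
  have key := poisson C fun _ _ => 1
  have e : ∀ x ∈ words C, x ≠ 0 → ∏ i, ((1 : ℝ) + sgn (x i) * 1) = 0 := by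
    intro x _ hx
    obtain ⟨i, hi⟩ := Function.ne_iff.1 hx
    refine Finset.prod_eq_zero (Finset.mem_univ i) ?_
    rw [(zmod_two_cases (x i)).resolve_left hi]
    simp
  rw [Finset.sum_eq_single 0 e (fun h => absurd (mem_words.2 C.zero_mem) h)] at key
  norm_num at key
  exact_mod_cast key.symm

theorem le_dual_dual {n : ℕ} (C : Code n) : C ≤ dual (dual C) := by
  intro x hx y hy
  have := hy x hx
  simpa [mul_comm] using this

theorem eq_of_le_of_card_le {n : ℕ} {C D : Code n} (h : C ≤ D)
    (hc : (words D).card ≤ (words C).card) : C = D := by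
  have : words C = words D := Finset.eq_of_subset_of_card_le
    (fun x hx => mem_words.2 (h (mem_words.1 hx))) hc
  ext x
  rw [← mem_words, this, mem_words]

theorem card_words_pos {n : ℕ} (C : Code n) : 0 < (words C).card :=
  Finset.card_pos.2 ⟨0, mem_words.2 C.zero_mem⟩

theorem dual_dual {n : ℕ} (C : Code n) : dual (dual C) = C := by
  refine (eq_of_le_of_card_le (le_dual_dual C) (le_of_eq ?_)).symm
  have h1 := card_words_mul_card_words_dual C
  have h2 := card_words_mul_card_words_dual (dual C)
  rw [← h1, mul_comm] at h2
  exact Nat.eq_of_mul_eq_mul_right (card_words_pos (dual C)) h2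

theorem sum_self_mul {n : ℕ} (x : Fin n → ZMod 2) : ∑ i, x i = (hammingNorm x : ZMod 2) := by
  have : ∀ i, x i = if x i ≠ 0 then 1 else 0 := by
    intro i
    rcases zmod_two_cases (x i) with h | h <;> simp [h]
  rw [Finset.sum_congr rfl fun i _ => this i, hammingNorm, Finset.sum_boole]

theorem even_hammingNorm_iff {n : ℕ} (x : Fin n → ZMod 2) :
    2 ∣ hammingNorm x ↔ ∑ i, x i = 0 := by
  rw [sum_self_mul, ZMod.natCast_eq_zero_iff]

theorem hammingNorm_one_sub {n : ℕ} (x : Fin n → ZMod 2) :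
    hammingNorm (1 + x) + hammingNorm x = n := by
  have := Finset.card_filter_add_card_filter_not (s := (Finset.univ : Finset (Fin n)))
    (fun i => x i ≠ 0)
  simp only [Finset.card_univ, Fintype.card_fin] at this
  rw [hammingNorm, hammingNorm, add_comm]
  refine Eq.trans (congrArg _ (congrArg _ ?_)) this
  ext i
  simp only [Finset.mem_filter, Finset.mem_univ, true_and, Pi.add_apply, Pi.one_apply]
  generalize x i = a
  revert a; decide

theorem eq_one_of_hammingNorm {n : ℕ} {x : Fin n → ZMod 2} (h : hammingNorm x = n) : x = 1 := by
  have h' := hammingNorm_one_sub x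
  have : hammingNorm (1 + x) = 0 := by omega
  rw [hammingNorm_eq_zero] at this
  ext i
  have := congrFun this i
  simp only [Pi.add_apply, Pi.one_apply, Pi.zero_apply] at this ⊢
  revert this
  generalize x i = a
  revert a; decide

theorem hammingNorm_one {n : ℕ} : hammingNorm (1 : Fin n → ZMod 2) = n := by
  simp [hammingNorm]

/-! ### Near-extremal codes of length 8m. -/

/-- The properties shared by a near-extremal even formally self-dual code of length `8 m` and its
dual. -/
structure IsBalanced {m : ℕ} (D : Code (8 * m)) : Prop where
  even : ∀ x ∈ D, 2 ∣ hammingNorm x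
  le_weight : ∀ x ∈ D, x ≠ 0 → 2 * m ≤ hammingNorm x
  one_mem : 1 ∈ D
  card_eq : (words D).card = 2 ^ (4 * m)

theorem card_words_eq_sum {n : ℕ} (C : Code n) :
    (words C).card = ∑ w ∈ Finset.range (n + 1), (wordsOfWeight C w).card := by
  rw [Finset.card_eq_sum_card_fiberwise (f := hammingNorm) (t := Finset.range (n + 1))]
  · refine Finset.sum_congr rfl fun w _ => congrArg _ ?_
    ext x
    simp [mem_wordsOfWeight]
  · intro x _
    simpa [Nat.lt_succ_iff] using hammingNorm_le x

/-- Evenness of C puts the all-one word in the dual; the common weight distribution then gives C a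
word of full weight, and transfers evenness and minimum distance to the dual. -/
theorem balanced_of_formallySelfDual {m : ℕ} {C : Code (8 * m)} (h : IsEvenFormallySelfDual C)
    (hd : IsNearExtremal C) : IsBalanced C ∧ IsBalanced (dual C) := by
  obtain ⟨he, hw⟩ := h
  have hmin : ∀ x ∈ C, x ≠ 0 → 2 * m ≤ hammingNorm x := by
    intro x hx h0
    have := hd.2 ⟨x, hx, h0, rfl⟩
    rwa [Nat.mul_div_cancel_left m (by norm_num)] at this
  have htr : ∀ x ∈ dual C, ∃ y ∈ C, hammingNorm y = hammingNorm x := by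
    intro x hx
    have hpos : 0 < (wordsOfWeight (dual C) (hammingNorm x)).card :=
      Finset.card_pos.2 ⟨x, mem_wordsOfWeight.2 ⟨hx, rfl⟩⟩
    rw [← hw] at hpos
    obtain ⟨y, hy⟩ := Finset.card_pos.1 hpos
    exact ⟨y, (mem_wordsOfWeight.1 hy).1, (mem_wordsOfWeight.1 hy).2⟩
  have hcard : (words C).card = (words (dual C)).card := by
    rw [card_words_eq_sum, card_words_eq_sum]
    exact Finset.sum_congr rfl fun w _ => hw w
  have hc : (words C).card = 2 ^ (4 * m) := by
    have := card_words_mul_card_words_dual C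
    rw [← hcard, ← sq] at this
    refine Nat.pow_left_injective (by norm_num : 2 ≠ 0) (this.trans ?_)
    simp only [← pow_mul]
    ring
  have h1 : (1 : Fin (8 * m) → ZMod 2) ∈ dual C := by
    intro x hx
    simpa using (even_hammingNorm_iff x).1 (he x hx)
  refine ⟨⟨he, hmin, ?_, hc⟩, ⟨?_, ?_, h1, hcard ▸ hc⟩⟩
  · obtain ⟨y, hy, hn⟩ := htr 1 h1
    rw [hammingNorm_one] at hn
    rwa [← eq_one_of_hammingNorm hn]
  · intro x hx
    obtain ⟨y, hy, hn⟩ := htr x hx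
    exact hn ▸ he y hy
  · intro x hx h0
    obtain ⟨y, hy, hn⟩ := htr x hx
    rw [← hn]
    refine hmin y hy fun h => h0 ?_
    rw [h, hammingNorm_zero] at hn
    exact hammingNorm_eq_zero.1 hn.symm

theorem IsTypeI.isEvenFormallySelfDual {n : ℕ} {C : Code n} (h : IsTypeI C) :
    IsEvenFormallySelfDual C := by
  refine ⟨fun x hx => (even_hammingNorm_iff x).2 ?_, fun w => by rw [h.1]⟩
  have hx' : x ∈ dual C := h.1.symm ▸ hx
  rw [← hx' x hx]
  refine Finset.sum_congr rfl fun i _ => ?_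
  generalize x i = a
  revert a; decide

/-! ### Factoring polynomials with a MacWilliams functional equation. -/

theorem natDegree_one_sub_X_sq : (1 - X ^ 2 : ℝ[X]).natDegree = 2 := by
  compute_degree!

theorem one_sub_X_sq_ne_zero : (1 - X ^ 2 : ℝ[X]) ≠ 0 := by
  intro h
  have := natDegree_one_sub_X_sq
  simp [h] at this

theorem eq_of_eval_eq_Ioo {P Q : ℝ[X]} (h : ∀ y : ℝ, 0 < y → y < 1 → P.eval y = Q.eval y) :
    P = Q :=
  eq_of_infinite_eval_eq P Q
    ((Set.Ioo_infinite (zero_lt_one' ℝ)).mono fun y hy => h y hy.1 hy.2)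

/-- A polynomial with a functional equation of MacWilliams type and with even exponents between
`2 m` and `6 m` has all but `2 e` of its zeros at `0` and `±1`. -/
theorem exists_factor {m e : ℕ} (he : e ≤ 2 * m) {Z : ℝ[X]}
    (hs : ∀ w, Z.coeff w ≠ 0 → 2 ∣ w ∧ 2 * m ≤ w ∧ w ≤ 6 * m)
    (hT : ∀ y : ℝ, 0 < y → y < 1 → 2 ^ (4 * m) * (1 - y ^ 2) ^ e * Z.eval y =
      (-2 * y) ^ e * (1 + y) ^ (8 * m) * Z.eval ((1 - y) / (1 + y))) :
    ∃ Q : ℝ[X], Z = X ^ (2 * m) * (1 - X ^ 2) ^ (2 * m - e) * Q ∧ Q.natDegree ≤ 2 * e ∧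
      (∀ k, ¬ 2 ∣ k → Q.coeff k = 0) ∧
      ∀ y : ℝ, 0 < y → y < 1 →
        2 ^ e * Q.eval y = (-1) ^ e * (1 + y) ^ (2 * e) * Q.eval ((1 - y) / (1 + y)) := by
  set T : ℝ[X] := ∑ w ∈ Z.support, Polynomial.C (Z.coeff w) * ((1 + X) ^ (8 * m - w) * (1 - X) ^ w)
    with hTdef
  have hTe : ∀ y : ℝ, 0 < y → T.eval y = (1 + y) ^ (8 * m) * Z.eval ((1 - y) / (1 + y)) := by
    intro y hy
    have hp : 1 + y ≠ 0 := by positivity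
    rw [eval_eq_sum (p := Z), sum_def, Finset.mul_sum, hTdef, eval_finsetSum]
    refine Finset.sum_congr rfl fun w hw => ?_
    have := (hs w (mem_support_iff.1 hw)).2.2
    have h : (1 + y) ^ (8 * m) = (1 + y) ^ (8 * m - w) * (1 + y) ^ w := by
      rw [← pow_add]; congr 1; omega
    rw [h, div_pow]
    simp only [eval_mul, eval_C, eval_pow, eval_add, eval_sub, eval_one, eval_X]
    field_simp
  -- Exponents in [2m, 6m] leave at least 2m factors 1-X and 2m factors 1+X in every term.
  have hdT : (1 - X ^ 2 : ℝ[X]) ^ (2 * m) ∣ T := by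
    refine Finset.dvd_sum fun w hw => Dvd.dvd.mul_left ?_ _
    obtain ⟨-, h1, h2⟩ := hs w (mem_support_iff.1 hw)
    rw [show (1 - X ^ 2 : ℝ[X]) = (1 + X) * (1 - X) by ring, mul_pow]
    exact mul_dvd_mul (pow_dvd_pow _ (by omega)) (pow_dvd_pow _ h1)
  have hZT : Polynomial.C ((2 : ℝ) ^ (4 * m)) * (1 - X ^ 2) ^ e * Z = (-2 * X) ^ e * T := by
    refine eq_of_eval_eq_Ioo fun y h0 h1 => ?_
    have := hT y h0 h1
    rw [mul_assoc _ ((1 + y) ^ (8 * m)), ← hTe y h0] at this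
    simpa using this
  -- The functional equation already carries (1-X²)^e next to Z, so only the remaining 2m-e factors
  -- must divide Z.
  have hd1 : (1 - X ^ 2 : ℝ[X]) ^ (2 * m - e) ∣ Z := by
    have h1 : (1 - X ^ 2 : ℝ[X]) ^ e * (1 - X ^ 2) ^ (2 * m - e) ∣
        (1 - X ^ 2) ^ e * (Polynomial.C ((2 : ℝ) ^ (4 * m)) * Z) := by
      rw [← pow_add, Nat.add_sub_cancel' he]
      have : (1 - X ^ 2 : ℝ[X]) ^ e * (Polynomial.C ((2 : ℝ) ^ (4 * m)) * Z) =
        (-2 * X) ^ e * T := by rw [← hZT]; ring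
      rw [this]
      exact hdT.mul_left _
    have h2 := (mul_dvd_mul_iff_left (pow_ne_zero e one_sub_X_sq_ne_zero)).1 h1
    exact (IsUnit.dvd_mul_left (isUnit_C.2 (IsUnit.mk0 _ (by positivity)))).1 h2
  have hd2 : (X : ℝ[X]) ^ (2 * m) ∣ Z := by
    rw [X_pow_dvd_iff]
    intro d hd
    by_contra h
    have := (hs d h).2.1
    omega
  have hcop : IsCoprime ((X : ℝ[X]) ^ (2 * m)) ((1 - X ^ 2) ^ (2 * m - e)) :=
    IsCoprime.pow ⟨X, 1, by ring⟩
  obtain ⟨Q, hQ⟩ := hcop.mul_dvd hd2 hd1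
  have hP0 : (X : ℝ[X]) ^ (2 * m) * (1 - X ^ 2) ^ (2 * m - e) ≠ 0 :=
    mul_ne_zero (pow_ne_zero _ X_ne_zero) (pow_ne_zero _ one_sub_X_sq_ne_zero)
  refine ⟨Q, hQ, ?_, ?_, ?_⟩
  · by_cases hQ0 : Q = 0
    · simp [hQ0]
    · have hZ0 : Z ≠ 0 := hQ ▸ mul_ne_zero hP0 hQ0
      have h1 : Z.natDegree ≤ 6 * m :=
        (hs _ (by simpa using hZ0)).2.2
      rw [hQ, natDegree_mul hP0 hQ0, natDegree_mul (pow_ne_zero _ X_ne_zero)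
        (pow_ne_zero _ one_sub_X_sq_ne_zero), natDegree_pow, natDegree_pow, natDegree_X,
        natDegree_one_sub_X_sq] at h1
      omega
  · have hZc : Z.comp (-X) = Z := by
      refine Polynomial.funext fun y => ?_
      rw [eval_comp, eval_eq_sum (p := Z), eval_eq_sum (p := Z), sum_def, sum_def]
      refine Finset.sum_congr rfl fun w hw => ?_
      have := (hs w (mem_support_iff.1 hw)).1
      simp only [eval_neg, eval_X]
      rw [Even.neg_pow (even_iff_two_dvd.2 this)]
    have hQc : Q.comp (-X) = Q := by
      refine mul_left_cancel₀ hP0 ?_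
      rw [← hQ, ← hZc, hQ]
      simp only [mul_comp, pow_comp, X_comp, sub_comp, one_comp]
      rw [Even.neg_pow (by simp), neg_sq]
    intro k hk
    have h1 := congrArg (fun P => P.coeff k) hQc
    simp only [show (-X : ℝ[X]) = Polynomial.C (-1) * X by simp, comp_C_mul_X_coeff] at h1
    have : Odd k := by rwa [← Nat.not_even_iff_odd, even_iff_two_dvd]
    rw [this.neg_one_pow] at h1
    linarith
  · intro y h0 h1
    have hp : 1 + y ≠ 0 := by positivity
    have hq : 1 - y ≠ 0 := by linarith
    have key := hT y h0 h1
    obtain ⟨r, hr⟩ := Nat.exists_eq_add_of_le he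
    have hr' : 2 * m - e = r := by omega
    rw [hQ, hr', show 4 * m = 2 * (e + r) by omega, show 8 * m = 4 * (e + r) by omega, hr] at key
    simp only [eval_mul, eval_pow, eval_X, eval_sub, eval_one] at key
    generalize Q.eval y = a at *
    generalize Q.eval ((1 - y) / (1 + y)) = b at *
    have hu : 1 - ((1 - y) / (1 + y)) ^ 2 = 4 * y / (1 + y) ^ 2 := by
      field_simp
      ring
    rw [hu] at key
    -- This is the common factor of the two sides of `key`, up to powers of 1+y, once Z is replaced
    -- by its factorisation.
    have hK : (2 : ℝ) ^ e * 4 ^ r * (y ^ (e + r) * ((1 + y) * (1 - y)) ^ (e + r)) ≠ 0 := by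
      positivity
    refine mul_left_cancel₀ hK ?_
    rw [show (1 : ℝ) - y ^ 2 = (1 + y) * (1 - y) by ring] at key
    have e1 : (2 : ℝ) ^ e * 4 ^ r * (y ^ (e + r) * ((1 + y) * (1 - y)) ^ (e + r)) * (2 ^ e * a) =
        2 ^ (2 * (e + r)) * ((1 + y) * (1 - y)) ^ e *
          (y ^ (e + r) * ((1 + y) * (1 - y)) ^ r * a) := by
      rw [show (2 : ℝ) ^ (2 * (e + r)) = 2 ^ e * 2 ^ e * 4 ^ r by
        rw [show (4 : ℝ) = 2 ^ 2 by norm_num, ← pow_mul, ← pow_add, ← pow_add]; congr 1; omega]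
      ring
    rw [e1, key, div_pow, div_pow, mul_pow 4 y r, ← pow_mul, neg_mul, neg_pow, mul_pow 2 y e,
      mul_pow (1 + y)]
    rw [show (1 + y) ^ (4 * (e + r)) = (1 + y) ^ (e + r) * (1 + y) ^ (2 * r) * (1 + y) ^ (2 * e) *
        (1 + y) ^ (e + r) by rw [← pow_add, ← pow_add, ← pow_add]; congr 1; omega]
    field_simp
    ring

/-! ### Counting in designs -/

/-- The number of blocks of `B` that contain `T`, counted with multiplicity. -/
noncomputable def cov {X : Type*} (B : Multiset (Finset X)) (T : Finset X) : ℕ :=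
  B.countP fun b => T ⊆ b

theorem cov_add {X : Type*} (B B' : Multiset (Finset X)) (T : Finset X) :
    cov (B + B') T = cov B T + cov B' T := Multiset.countP_add _ _ _

theorem cov_cons {X : Type*} (b : Finset X) (B : Multiset (Finset X)) (T : Finset X) :
    cov (b ::ₘ B) T = cov B T + if T ⊆ b then 1 else 0 := Multiset.countP_cons _ _ _

theorem IsDesign.cov_eq {X : Type*} [Fintype X]
    {B : Multiset (Finset X)} {t v k l : ℕ}
    (h : IsDesign B t v k l) {T : Finset X} (hT : T.card = t) : cov B T = l := h.2.2.2.2 T hT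

/-- Double counting of the pairs (x, b) with x outside T and b containing T and x. It drives all
parameter relations of designs below. -/
theorem sum_cov_insert {X : Type*} [Fintype X] [DecidableEq X] {B : Multiset (Finset X)} {k : ℕ}
    (hB : ∀ b ∈ B, b.card = k) (T : Finset X) :
    ∑ x ∈ Tᶜ, cov B (insert x T) = (k - T.card) * cov B T := by
  induction B using Multiset.induction_on with
  | empty => simp [cov]
  | cons b B ih =>
    have ih' := ih fun b' hb' => hB b' (Multiset.mem_cons_of_mem hb')
    have hb := hB b (Multiset.mem_cons_self b B)
    simp only [cov_cons, Finset.sum_add_distrib, ih', mul_add]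
    congr 1
    by_cases hT : T ⊆ b
    · simp only [hT, if_true, mul_one, Finset.insert_subset_iff, and_true]
      rw [← Finset.card_filter, ← hb, ← Finset.card_sdiff_of_subset hT]
      congr 1
      ext x
      simp [and_comm]
    · simp [hT, Finset.insert_subset_iff]

theorem IsDesign.pred {X : Type*} [Fintype X] [DecidableEq X]
    {B : Multiset (Finset X)} {t v k l : ℕ}
    (h : IsDesign B (t + 1) v k l) : ∃ l', IsDesign B t v k l' := by
  obtain ⟨hv, htk, hkv, hB, hT⟩ := h
  refine ⟨(v - t) * l / (k - t), hv, by omega, hkv, hB, fun T hTc => ?_⟩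
  have key := sum_cov_insert hB T
  rw [Finset.sum_congr rfl (g := fun _ => l), Finset.sum_const, Finset.card_compl, hv, hTc,
    smul_eq_mul] at key
  · change cov B T = _
    rw [key, Nat.mul_div_cancel_left _ (by omega)]
  · intro x hx
    exact hT _ (by rw [Finset.card_insert_of_notMem (Finset.mem_compl.1 hx), hTc])

theorem IsDesign.of_le {X : Type*} [Fintype X] [DecidableEq X]
    {B : Multiset (Finset X)} {s t v k l : ℕ}
    (h : IsDesign B t v k l) (hst : s ≤ t) : ∃ l', IsDesign B s v k l' := by
  induction t generalizing l with
  | zero => exact ⟨l, by rwa [Nat.le_zero.1 hst]⟩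
  | succ t ih =>
    rcases Nat.of_le_succ hst with hst | rfl
    · obtain ⟨l', h'⟩ := h.pred
      exact ih h' hst
    · exact ⟨l, h⟩

theorem IsDesign.card_one_mul {X : Type*} [Fintype X] [DecidableEq X]
    {B : Multiset (Finset X)} {v k l : ℕ}
    (h : IsDesign B 1 v k l) : v * l = k * B.card := by
  obtain ⟨hv, htk, hkv, hB, hT⟩ := h
  have key := sum_cov_insert hB ∅
  rw [Finset.sum_congr rfl (g := fun _ => l)] at key
  · simpa [hv, cov] using key
  · intro x hx
    exact hT _ (by simp)

theorem IsDesign.card_two_mul {X : Type*} [Fintype X] [DecidableEq X]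
    {B : Multiset (Finset X)} {v k l : ℕ}
    (h : IsDesign B 2 v k l) : v * (v - 1) * l = k * (k - 1) * B.card := by
  obtain ⟨l', h'⟩ := h.pred
  have h1 := h'.card_one_mul
  by_cases hv0 : v = 0
  · have := h.2.2.1
    simp [hv0, show k = 0 by omega]
  have hne : Nonempty X := Fintype.card_pos_iff.1 (by rw [h.1]; omega)
  obtain ⟨x⟩ := hne
  have key := sum_cov_insert h.2.2.2.1 {x}
  rw [Finset.sum_congr rfl (g := fun _ => l), h'.cov_eq (Finset.card_singleton x),
    Finset.sum_const, Finset.card_compl, h.1, Finset.card_singleton, smul_eq_mul] at key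
  · calc v * (v - 1) * l = (k - 1) * (v * l') := by rw [mul_assoc, key]; ring
      _ = _ := by rw [h1]; ring
  · intro y hy
    exact h.2.2.2.2 _ (Finset.card_pair (by simpa using hy))

theorem isDesign_one {X : Type*} [Fintype X] [DecidableEq X] [Nonempty X]
    {B : Multiset (Finset X)} {k : ℕ}
    (hB : ∀ b ∈ B, b.card = k) (hk : 1 ≤ k) (hkv : k ≤ Fintype.card X)
    (h1 : ∀ i j : X, cov B {i} = cov B {j}) :
    ∃ l, IsDesign B 1 (Fintype.card X) k l := by
  obtain ⟨x⟩ := ‹Nonempty X›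
  refine ⟨cov B {x}, rfl, hk, hkv, hB, fun T hT => ?_⟩
  obtain ⟨y, rfl⟩ := Finset.card_eq_one.1 hT
  exact h1 y x

/-- A collection of blocks is a `2`-design as soon as it is orthogonal to the harmonic functions of
degrees one and two. -/
theorem isDesign_two {X : Type*} [Fintype X] [DecidableEq X] {B : Multiset (Finset X)} {k : ℕ}
    (hB : ∀ b ∈ B, b.card = k) (hk : 2 ≤ k) (hkv : k ≤ Fintype.card X)
    (h1 : ∀ i j : X, cov B {i} = cov B {j})
    (h2 : ∀ i j p q : X, i ≠ p → i ≠ q → j ≠ p → j ≠ q →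
      (cov B {i, p} : ℝ) - cov B {i, q} -
        cov B {j, p} + cov B {j, q} = 0) :
    ∃ l, IsDesign B 2 (Fintype.card X) k l := by
  set c : X → X → ℝ := fun i p => cov B {i, p} with hc
  have hcomm : ∀ i p, c i p = c p i := fun i p => by simp only [hc, Finset.pair_comm]
  have hsum : ∀ i, ∑ p ∈ {i}ᶜ, c i p = ((k - 1 : ℕ) : ℝ) * cov B {i} := by
    intro i
    have := sum_cov_insert hB {i}
    rw [Finset.card_singleton] at this
    rw [← Nat.cast_mul, ← this, Nat.cast_sum]
    refine Finset.sum_congr rfl fun p _ => ?_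
    simp only [hc, Finset.pair_comm i p]
  have step : ∀ i j p, i ≠ p → j ≠ p → c i p = c j p := by
    intro i j p hip hjp
    by_cases hij : i = j
    · rw [hij]
    have e : ∀ i j, i ≠ j → ∑ q ∈ {i}ᶜ, c i q = ∑ q ∈ ({i, j} : Finset X)ᶜ, c i q + c i j := by
      intro i j hij
      have : ({i}ᶜ : Finset X) = insert j ({i, j} : Finset X)ᶜ := by
        ext q
        simp only [Finset.mem_compl, Finset.mem_singleton, Finset.mem_insert, not_or]
        by_cases hq : q = j
        · simp [hq, hij.symm]
        · simp [hq]
      rw [this, Finset.sum_insert (by simp), add_comm]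
    -- Equal point degrees make this sum vanish, while `h2` makes the summand independent of q;
    -- hence each summand is zero.
    have hd : ∑ q ∈ ({i, j} : Finset X)ᶜ, (c i q - c j q) = 0 := by
      have hi := e i j hij
      have hj := e j i (Ne.symm hij)
      rw [hsum, h1 i j, ← hsum j, hj, Finset.pair_comm j i, hcomm j i] at hi
      rw [Finset.sum_sub_distrib]
      linarith
    rw [Finset.sum_congr rfl (g := fun _ => c i p - c j p), Finset.sum_const, nsmul_eq_mul] at hd
    · have hp : p ∈ ({i, j} : Finset X)ᶜ := by simp [hip.symm, hjp.symm]
      have hpos : ((({i, j} : Finset X)ᶜ).card : ℝ) ≠ 0 :=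
        Nat.cast_ne_zero.2 (Finset.card_ne_zero_of_mem hp)
      have := (mul_eq_zero.1 hd).resolve_left hpos
      linarith
    · intro q hq
      simp only [Finset.mem_compl, Finset.mem_insert, Finset.mem_singleton, not_or] at hq
      have := h2 i j p q hip (Ne.symm hq.1) hjp (Ne.symm hq.2)
      simp only [hc]
      linarith
  have all : ∀ a b p q, a ≠ b → p ≠ q → c a b = c p q := by
    intro a b p q hab hpq
    by_cases hpb : p = b
    · subst hpb
      rw [step a q p hab (Ne.symm hpq), hcomm]
    · rw [step a p b hab hpb, hcomm p b, step b q p (Ne.symm hpb) (Ne.symm hpq), hcomm]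
  obtain ⟨x, y, hxy⟩ := Fintype.exists_pair_of_one_lt_card (α := X) (by omega)
  refine ⟨cov B {x, y}, rfl, hk, hkv, hB, fun T hT => ?_⟩
  obtain ⟨a, b, hab, rfl⟩ := Finset.card_eq_two.1 hT
  have := all a b x y hab hxy
  simp only [hc] at this
  exact_mod_cast this

/-! ### Blocks of codes -/

theorem card_of_mem_blocks {n : ℕ} {C : Code n} {w : ℕ} {b : Finset (Fin n)}
    (hb : b ∈ blocks C w) : b.card = w := by
  obtain ⟨x, hx, rfl⟩ := Multiset.mem_map.1 hb
  exact (mem_wordsOfWeight.1 (show x ∈ wordsOfWeight C w from hx)).2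

theorem card_blocks {n : ℕ} (C : Code n) (w : ℕ) :
    (blocks C w).card = (wordsOfWeight C w).card := by
  simp [blocks]

theorem cov_blocks {n : ℕ} (C : Code n) (w : ℕ) (T : Finset (Fin n)) :
    (cov (blocks C w) T : ℝ) =
      ∑ c ∈ wordsOfWeight C w, ∏ i ∈ T, bit (c i) := by
  rw [cov, blocks, Multiset.countP_map]
  have : ∀ c : Fin n → ZMod 2, ∏ i ∈ T, bit (c i) = if T ⊆ supp c then 1 else 0 := by
    intro c
    split_ifs with h
    · refine Finset.prod_eq_one fun i hi => ?_
      have := h hi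
      simp only [supp, Finset.mem_filter, Finset.mem_univ, true_and] at this
      simp [bit, this]
    · obtain ⟨i, hi, hi'⟩ := Finset.not_subset.1 h
      refine Finset.prod_eq_zero hi ?_
      simpa [supp, bit] using hi'
  simp_rw [this]
  rw [Finset.sum_boole, Finset.card_def, Finset.filter_val]
  congr!

theorem cov_blocks_singleton {n : ℕ} (C : Code n) (w : ℕ) (i : Fin n) :
    (cov (blocks C w) {i} : ℝ) = ∑ c ∈ wordsOfWeight C w, bit (c i) := by
  simpa using cov_blocks C w {i}

theorem cov_blocks_pair {n : ℕ} (C : Code n) (w : ℕ) {i j : Fin n} (hij : i ≠ j) :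
    (cov (blocks C w) {i, j} : ℝ) =
      ∑ c ∈ wordsOfWeight C w, bit (c i) * bit (c j) := by
  rw [cov_blocks]
  simp only [Finset.prod_pair hij]

/-! ### Harmonic enumerators of near-extremal codes -/

/-- The two vanishing conditions on g discard the zero and all-one words; for any other word the
minimum distance applies to it and to its complement. -/
theorem IsBalanced.support {m : ℕ} {D : Code (8 * m)} (h : IsBalanced D)
    {g : (Fin (8 * m) → ZMod 2) → ℝ} (g0 : g 0 = 0) (g1 : g 1 = 0) {w : ℕ}
    (hw : (enum D g).coeff w ≠ 0) : 2 ∣ w ∧ 2 * m ≤ w ∧ w ≤ 6 * m := by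
  rw [coeff_enum] at hw
  obtain ⟨c, hc, hg⟩ := Finset.exists_ne_zero_of_sum_ne_zero hw
  obtain ⟨hcD, rfl⟩ := mem_wordsOfWeight.1 hc
  refine ⟨h.even c hcD, h.le_weight c hcD fun h0 => hg (h0 ▸ g0), ?_⟩
  have h1 := h.le_weight (1 + c) (D.add_mem h.one_mem hcD) fun h0 => hg ?_
  · have := hammingNorm_one_sub c
    omega
  · have : c = 1 := by
      apply eq_one_of_hammingNorm
      have := hammingNorm_one_sub c
      rw [h0, hammingNorm_zero] at this
      omega
    exact this ▸ g1

theorem support_enum_add {m : ℕ} {C D : Code (8 * m)} (hC : IsBalanced C) (hD : IsBalanced D)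
    {g : (Fin (8 * m) → ZMod 2) → ℝ} (g0 : g 0 = 0) (g1 : g 1 = 0) (w : ℕ)
    (hw : (enum C g + enum D g).coeff w ≠ 0) : 2 ∣ w ∧ 2 * m ≤ w ∧ w ≤ 6 * m := by
  rw [coeff_add] at hw
  by_cases h : (enum C g).coeff w = 0
  · rw [h, zero_add] at hw
    exact hD.support g0 g1 hw
  · exact hC.support g0 g1 h

/-- The transform exchanges the enumerators of C and its dual, so their sum satisfies the hypothesis
of `exists_factor`, which leaves an even Q of degree at most 2. -/
theorem enum_sub_add_eq_zero {m : ℕ} (hm : 1 ≤ m) {C : Code (8 * m)} (hC : IsBalanced C)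
    (hD : IsBalanced (dual C)) (i j : Fin (8 * m)) :
    enum C (fun c => bit (c i) - bit (c j)) +
      enum (dual C) (fun c => bit (c i) - bit (c j)) = 0 := by
  obtain ⟨Q, hQ, hdeg, hodd, hT⟩ := exists_factor (m := m) (e := 1) (by omega)
    (support_enum_add hC hD (g := fun c => bit (c i) - bit (c j)) (by simp) (by simp)) (by
      intro y h0 h1
      have hA := macWilliams_sub C i j h0 h1
      have hB := macWilliams_sub (dual C) i j h0 h1
      rw [dual_dual, hD.card_eq] at hB
      rw [hC.card_eq] at hA
      push_cast at hA hB
      rw [eval_add, eval_add, pow_one, pow_one]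
      linear_combination hA + hB)
  have hev : ∀ y, Q.eval y = Q.coeff 0 + Q.coeff 2 * y ^ 2 := by
    intro y
    rw [eval_eq_sum_range' (n := 3) (by omega)]
    simp [Finset.sum_range_succ, hodd 1 (by norm_num)]
  -- Two sample points give enough linear equations to force both coefficients to be zero.
  have h2 := hT (1 / 2) (by norm_num) (by norm_num)
  have h4 := hT (1 / 4) (by norm_num) (by norm_num)
  simp only [hev] at h2 h4
  norm_num at h2 h4
  have hQ0 : Q = 0 := by
    refine Polynomial.funext fun y => ?_
    rw [hev, show Q.coeff 0 = 0 by linarith, show Q.coeff 2 = 0 by linarith]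
    simp
  rw [hQ, hQ0, mul_zero]

theorem exists_enum_mul_add {m : ℕ} (hm : 1 ≤ m) {C : Code (8 * m)} (hC : IsBalanced C)
    (hD : IsBalanced (dual C)) {i j k l : Fin (8 * m)} (hik : i ≠ k) (hil : i ≠ l)
    (hjk : j ≠ k) (hjl : j ≠ l) :
    ∃ α : ℝ, enum C (fun c => (bit (c i) - bit (c j)) * (bit (c k) - bit (c l))) +
      enum (dual C) (fun c => (bit (c i) - bit (c j)) * (bit (c k) - bit (c l))) =
      Polynomial.C α * (X ^ (2 * m) * (1 - X ^ 2) ^ (2 * m - 2) * (1 + X ^ 2) ^ 2) := by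
  obtain ⟨Q, hQ, hdeg, hodd, hT⟩ := exists_factor (m := m) (e := 2) (by omega)
    (support_enum_add hC hD (g := fun c => (bit (c i) - bit (c j)) * (bit (c k) - bit (c l)))
      (by simp) (by simp)) (by
      intro y h0 h1
      have hA := macWilliams_sub_mul_sub C hik hil hjk hjl h0 h1
      have hB := macWilliams_sub_mul_sub (dual C) hik hil hjk hjl h0 h1
      rw [dual_dual, hD.card_eq] at hB
      rw [hC.card_eq] at hA
      push_cast at hA hB
      rw [eval_add, eval_add]
      linear_combination hA + hB)
  have hev : ∀ y, Q.eval y = Q.coeff 0 + Q.coeff 2 * y ^ 2 + Q.coeff 4 * y ^ 4 := by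
    intro y
    rw [eval_eq_sum_range' (n := 5) (by omega)]
    simp [Finset.sum_range_succ, hodd 1 (by norm_num), hodd 3 (by norm_num)]
  have h2 := hT (1 / 2) (by norm_num) (by norm_num)
  have h4 := hT (1 / 4) (by norm_num) (by norm_num)
  simp only [hev] at h2 h4
  norm_num at h2 h4
  -- Among even polynomials of degree at most 4, the functional equation admits only multiples of
  -- (1+X²)².
  have hQ0 : Q = Polynomial.C (Q.coeff 0) * (1 + X ^ 2) ^ 2 := by
    refine Polynomial.funext fun y => ?_
    rw [hev, show Q.coeff 2 = 2 * Q.coeff 0 by linarith, show Q.coeff 4 = Q.coeff 0 by linarith]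
    simp
    ring
  refine ⟨Q.coeff 0, ?_⟩
  rw [hQ]
  nth_rewrite 1 [hQ0]
  ring

/-- The harmonic weight enumerator of degree two, up to a scalar factor. -/
noncomputable def harmonicTwo (m : ℕ) : ℝ[X] :=
  X ^ (2 * m) * (1 - X ^ 2) ^ (2 * m - 2) * (1 + X ^ 2) ^ 2

/-! ### Unions of the support designs of a code and its dual. -/

section Union

variable {m : ℕ} {C : Code (8 * m)}

theorem cov_union_singleton (hm : 1 ≤ m) (hC : IsBalanced C) (hD : IsBalanced (dual C))
    (w : ℕ) (i j : Fin (8 * m)) :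
    cov (blocks C w + blocks (dual C) w) {i} =
      cov (blocks C w + blocks (dual C) w) {j} := by
  have h := congrArg (fun P => P.coeff w) (enum_sub_add_eq_zero hm hC hD i j)
  simp only [coeff_add, coeff_enum, Finset.sum_sub_distrib, ← cov_blocks_singleton,
    coeff_zero] at h
  simp only [cov_add]
  have h' : (cov (blocks C w) {i} : ℝ) +
      cov (blocks (dual C) w) {i} = cov (blocks C w) {j} +
      cov (blocks (dual C) w) {j} := by linarith
  exact_mod_cast h'

theorem exists_cov_union_pair (hm : 1 ≤ m) (hC : IsBalanced C) (hD : IsBalanced (dual C))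
    {i j p q : Fin (8 * m)} (hip : i ≠ p) (hiq : i ≠ q) (hjp : j ≠ p) (hjq : j ≠ q) :
    ∃ α : ℝ, ∀ w,
      (cov (blocks C w + blocks (dual C) w) {i, p} : ℝ) -
        cov (blocks C w + blocks (dual C) w) {i, q} -
        cov (blocks C w + blocks (dual C) w) {j, p} +
        cov (blocks C w + blocks (dual C) w) {j, q} =
      α * (harmonicTwo m).coeff w := by
  obtain ⟨α, hα⟩ := exists_enum_mul_add hm hC hD hip hiq hjp hjq
  refine ⟨α, fun w => ?_⟩
  have h := congrArg (fun P => P.coeff w) hα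
  simp only [coeff_add, coeff_enum, coeff_C_mul] at h
  rw [harmonicTwo, ← h]
  simp only [cov_add, Nat.cast_add, cov_blocks_pair _ _ hip,
    cov_blocks_pair _ _ hiq, cov_blocks_pair _ _ hjp, cov_blocks_pair _ _ hjq,
    sub_mul, mul_sub, Finset.sum_sub_distrib]
  ring

theorem card_of_mem_union {w : ℕ} {b : Finset (Fin (8 * m))}
    (hb : b ∈ blocks C w + blocks (dual C) w) : b.card = w := by
  rcases Multiset.mem_add.1 hb with hb | hb <;> exact card_of_mem_blocks hb

/-- The union of the support designs of `C` and its dual is a `2`-design in each weight at which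
the harmonic weight enumerator of degree two vanishes. -/
theorem isDesign_two_union (hm : 1 ≤ m) (hC : IsBalanced C) (hD : IsBalanced (dual C)) {w : ℕ}
    (hw : 2 ≤ w) (hwn : w ≤ 8 * m) (h0 : (harmonicTwo m).coeff w = 0) :
    ∃ l, IsDesign (blocks C w + blocks (dual C) w) 2 (8 * m) w l := by
  have := isDesign_two (B := blocks C w + blocks (dual C) w) (k := w)
    (fun b hb => card_of_mem_union hb) hw (by simpa using hwn)
    (cov_union_singleton hm hC hD w) (fun i j p q hip hiq hjp hjq => by
      obtain ⟨α, hα⟩ := exists_cov_union_pair hm hC hD hip hiq hjp hjq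
      rw [hα w, h0, mul_zero])
  simpa using this

end Union

/-! ### Vanishing coefficients of the degree-two harmonic enumerator. -/

theorem harmonicTwo_two : harmonicTwo 2 = X ^ 4 - 2 * X ^ 8 + X ^ 12 := by
  simp only [harmonicTwo]
  norm_num
  ring

theorem harmonicTwo_eight : harmonicTwo 8 =
    X ^ 16 - 12 * X ^ 18 + 64 * X ^ 20 - 196 * X ^ 22 + 364 * X ^ 24 - 364 * X ^ 26
      + 572 * X ^ 30 - 858 * X ^ 32 + 572 * X ^ 34 - 364 * X ^ 38 + 364 * X ^ 40 - 196 * X ^ 42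
      + 64 * X ^ 44 - 12 * X ^ 46 + X ^ 48 := by
  simp only [harmonicTwo]
  norm_num
  ring

/-- For m = 2 the factors 1-X² and 1+X² occur equally often, and X^4 (1-X^4)² has only exponents
divisible by 4. -/
theorem coeff_harmonicTwo_two : (harmonicTwo 2).coeff 6 = 0 ∧ (harmonicTwo 2).coeff 10 = 0 := by
  rw [harmonicTwo_two]
  constructor <;> simp [coeff_X_pow, coeff_ofNat_mul]

/-- With z = X², the coefficient of z^6 in (1-z)^14 (1+z)² is C(14,6) - 2C(14,5) + C(14,4) = 3003 -
4004 + 1001 = 0; weight 36 is its mirror image. -/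
theorem coeff_harmonicTwo_eight :
    (harmonicTwo 8).coeff 28 = 0 ∧ (harmonicTwo 8).coeff 36 = 0 := by
  rw [harmonicTwo_eight]
  constructor <;> simp [coeff_X_pow, coeff_ofNat_mul]

theorem coeff_harmonicTwo_ne_zero {m : ℕ} (hm : m = 1 ∨ m = 3 ∨ m = 4) {w : ℕ} (h2 : 2 ∣ w)
    (h3 : 2 * m ≤ w) (h4 : w ≤ 6 * m) : (harmonicTwo m).coeff w ≠ 0 := by
  rcases hm with rfl | rfl | rfl
  · have : harmonicTwo 1 = X ^ 2 + 2 * X ^ 4 + X ^ 6 := by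
      simp only [harmonicTwo]
      norm_num
      ring
    rw [this]
    obtain ⟨k, rfl⟩ := h2
    have hk1 : 1 ≤ k := by omega
    have hk2 : k ≤ 3 := by omega
    interval_cases k <;> simp [coeff_X_pow, coeff_ofNat_mul]
  · have : harmonicTwo 3 = X ^ 6 - 2 * X ^ 8 - X ^ 10 + 4 * X ^ 12 - X ^ 14 - 2 * X ^ 16
        + X ^ 18 := by
      simp only [harmonicTwo]
      norm_num
      ring
    rw [this]
    obtain ⟨k, rfl⟩ := h2
    have hk1 : 3 ≤ k := by omega
    have hk2 : k ≤ 9 := by omega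
    interval_cases k <;> simp [coeff_X_pow, coeff_ofNat_mul]
  · have : harmonicTwo 4 = X ^ 8 - 4 * X ^ 10 + 4 * X ^ 12 + 4 * X ^ 14 - 10 * X ^ 16 + 4 * X ^ 18
        + 4 * X ^ 20 - 4 * X ^ 22 + X ^ 24 := by
      simp only [harmonicTwo]
      norm_num
      ring
    rw [this]
    obtain ⟨k, rfl⟩ := h2
    have hk1 : 4 ≤ k := by omega
    have hk2 : k ≤ 12 := by omega
    interval_cases k <;> simp [coeff_X_pow, coeff_ofNat_mul]

/-! ### Support designs of self-dual codes. -/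

section SelfDual

variable {m : ℕ} {C : Code (8 * m)}

theorem isSupportDesign_one (hm : 1 ≤ m) (hs : dual C = C) (hC : IsBalanced C) {w : ℕ}
    (hw : w ∈ properWeights C) : IsSupportDesign C w 1 := by
  have : Nonempty (Fin (8 * m)) := ⟨⟨0, by omega⟩⟩
  have := isDesign_one (B := blocks C w) (k := w) (fun b hb => card_of_mem_blocks hb) hw.1
    (by simpa using hw.2.1.le) fun i j => by
      have := cov_union_singleton hm hC (hs.symm ▸ hC) w i j
      rw [hs] at this
      simp only [cov_add] at this
      omega
  simpa [IsSupportDesign] using this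

theorem isSupportDesign_two_of_coeff (hm : 1 ≤ m) (hs : dual C = C) (hC : IsBalanced C) {w : ℕ}
    (hw : 2 ≤ w) (hwn : w ≤ 8 * m) (h0 : (harmonicTwo m).coeff w = 0) :
    IsSupportDesign C w 2 := by
  obtain ⟨l, h⟩ := isDesign_two_union hm hC (hs.symm ▸ hC) hw hwn h0
  rw [hs] at h
  obtain ⟨h1, h2, h3, h4, h5⟩ := h
  -- For a self-dual code the union counts every block twice.
  refine ⟨l / 2, h1, h2, h3, fun b hb => card_of_mem_blocks hb, fun T hT => ?_⟩
  have : cov (blocks C w + blocks C w) T = l := h5 T hT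
  change cov (blocks C w) T = _
  rw [cov_add] at this
  omega

/-- If the harmonic weight enumerator of degree two has no accidental zeros, then all support
designs are `2`-designs as soon as one of them is. -/
theorem isSupportDesign_two_transfer (hm : 1 ≤ m) (hs : dual C = C) (hC : IsBalanced C)
    {w : ℕ} (h0 : (harmonicTwo m).coeff w ≠ 0) (hw : IsSupportDesign C w 2) {w' : ℕ}
    (hw' : 2 ≤ w') (hwn' : w' ≤ 8 * m) : IsSupportDesign C w' 2 := by
  obtain ⟨l, hl⟩ := hw
  have := isDesign_two (B := blocks C w') (k := w')
    (fun b hb => card_of_mem_blocks hb) hw' (by simpa using hwn')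
    (fun i j => by
      have := cov_union_singleton hm hC (hs.symm ▸ hC) w' i j
      rw [hs] at this
      simp only [cov_add] at this
      omega)
    (fun i j p q hip hiq hjp hjq => by
      obtain ⟨α, hα⟩ := exists_cov_union_pair hm hC (hs.symm ▸ hC) hip hiq hjp hjq
      rw [hs] at hα
      have h1 := hα w
      have hc : ∀ a b : Fin (8 * m), a ≠ b → cov (blocks C w) {a, b} = l :=
        fun a b hab => hl.cov_eq (Finset.card_pair hab)
      simp only [cov_add, hc _ _ hip, hc _ _ hiq, hc _ _ hjp, hc _ _ hjq] at h1
      -- The scalar α does not depend on the weight, so its vanishing at w carries over to w'.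
      have h2 : α * (harmonicTwo m).coeff w = 0 := by rw [← h1]; ring
      have h3 := hα w'
      rw [(mul_eq_zero.1 h2).resolve_right h0, zero_mul] at h3
      simp only [cov_add, Nat.cast_add] at h3
      linarith)
  simpa [IsSupportDesign] using this

end SelfDual

/-! ### Intersections of codewords and shadow characters. -/

theorem hammingNorm_add {n : ℕ} (x y : Fin n → ZMod 2) :
    hammingNorm (x + y) + 2 * hammingNorm (x * y) = hammingNorm x + hammingNorm y := by
  simp only [hammingNorm, Finset.card_filter, Finset.mul_sum]
  rw [← Finset.sum_add_distrib, ← Finset.sum_add_distrib]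
  refine Finset.sum_congr rfl fun i _ => ?_
  simp only [Pi.add_apply, Pi.mul_apply]
  rcases zmod_two_cases (x i) with h | h <;> rcases zmod_two_cases (y i) with h' | h' <;>
    simp [h, h', show (1 : ZMod 2) + 1 = 0 by decide]

theorem even_hammingNorm_mul {n : ℕ} {C : Code n} (hs : dual C = C) {x y : Fin n → ZMod 2}
    (hx : x ∈ C) (hy : y ∈ C) : 2 ∣ hammingNorm (x * y) := by
  rw [even_hammingNorm_iff]
  rw [← hs] at hy
  exact hy x hx

theorem even_of_self_dual {n : ℕ} {C : Code n} (hs : dual C = C) {x : Fin n → ZMod 2}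
    (hx : x ∈ C) : 2 ∣ hammingNorm x := by
  have := even_hammingNorm_mul hs hx hx
  have h := hammingNorm_add x x
  rw [show x + x = 0 from funext fun i => CharTwo.add_self_eq_zero (x i), hammingNorm_zero] at h
  omega

/-- The characters `c ↦ (-1)^(wt c / 2 + ⟨c, u⟩)` of a self-dual code. -/
noncomputable def shadowChar {n : ℕ} (u c : Fin n → ZMod 2) : ℝ :=
  (-1) ^ (hammingNorm c / 2) * sgn (∑ i, c i * u i)

/-- Codewords meet in an even number of points, so wt(c+d) ≡ wt c + wt d mod 4 and half the weight
is additive mod 2. -/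
theorem shadowChar_add {n : ℕ} {C : Code n} (hs : dual C = C) (u : Fin n → ZMod 2)
    {c d : Fin n → ZMod 2} (hc : c ∈ C) (hd : d ∈ C) :
    shadowChar u (c + d) = shadowChar u c * shadowChar u d := by
  have h1 := hammingNorm_add c d
  obtain ⟨p, hp⟩ := even_hammingNorm_mul hs hc hd
  obtain ⟨q, hq⟩ := even_of_self_dual hs hc
  obtain ⟨r, hr⟩ := even_of_self_dual hs hd
  obtain ⟨s, hs'⟩ := even_of_self_dual hs (C.add_mem hc hd)
  have e : (-1 : ℝ) ^ (hammingNorm (c + d) / 2) =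
      (-1) ^ (hammingNorm c / 2) * (-1) ^ (hammingNorm d / 2) := by
    rw [← pow_add, hq, hr, hs', Nat.mul_div_cancel_left _ (by norm_num),
      Nat.mul_div_cancel_left _ (by norm_num), Nat.mul_div_cancel_left _ (by norm_num)]
    have : q + r = s + 2 * p := by omega
    rw [this, pow_add, pow_mul]
    norm_num
  simp only [shadowChar, Pi.add_apply, add_mul, Finset.sum_add_distrib, sgn_add, e]
  ring

theorem shadowChar_eq {n : ℕ} (u c : Fin n → ZMod 2) :
    shadowChar u c = 1 ∨ shadowChar u c = -1 := by
  rcases neg_one_pow_eq_or ℝ (hammingNorm c / 2) with h | h <;>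
    rcases zmod_two_cases (∑ i, c i * u i) with h' | h' <;> simp [shadowChar, h, h']

theorem sum_shadowChar {n : ℕ} {C : Code n} (hs : dual C = C) (u : Fin n → ZMod 2) :
    ∑ c ∈ words C, shadowChar u c =
      if ∀ c ∈ C, shadowChar u c = 1 then ((words C).card : ℝ) else 0 := by
  split_ifs with h
  · rw [Finset.sum_congr rfl fun c hc => h c (mem_words.1 hc)]
    simp
  · push Not at h
    obtain ⟨c₀, hc₀, h⟩ := h
    refine sum_words_eq_zero C _ hc₀ fun c hc => ?_
    rw [shadowChar_add hs u hc hc₀, (shadowChar_eq u c₀).resolve_left h]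
    ring

/-- The character at u = 0 is nontrivial because some weight is not divisible by 4; equivalently,
the zero vector is not in the shadow. -/
theorem sum_neg_one_pow {n : ℕ} {C : Code n} (h : IsTypeI C) :
    ∑ c ∈ words C, (-1 : ℝ) ^ (hammingNorm c / 2) = 0 := by
  have key := sum_shadowChar h.1 0
  rw [if_neg] at key
  · simpa [shadowChar] using key
  · intro h'
    refine h.2 fun x hx => ?_
    have := h' x hx
    simp only [shadowChar, Pi.zero_apply, mul_zero, Finset.sum_const_zero, sgn_zero,
      mul_one] at this
    have hev : Even (hammingNorm x / 2) := by
      by_contra ho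
      rw [Nat.not_even_iff_odd] at ho
      rw [ho.neg_one_pow] at this
      norm_num at this
    obtain ⟨q, hq⟩ := even_of_self_dual h.1 hx
    obtain ⟨r, hr⟩ := hev
    omega

/-! ### The weight enumerator of a near-extremal Type I code -/

/-- The weight enumerator in the variable `z = y²`. -/
noncomputable def halfEnum {n : ℕ} (C : Code n) : ℝ[X] := ∑ c ∈ words C, X ^ (hammingNorm c / 2)

theorem expand_halfEnum {n : ℕ} {C : Code n} (h : ∀ x ∈ C, 2 ∣ hammingNorm x) :
    expand ℝ 2 (halfEnum C) = enum C fun _ => 1 := by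
  simp only [halfEnum, enum, map_sum, map_pow, expand_X, map_one, one_mul]
  refine Finset.sum_congr rfl fun c hc => ?_
  rw [← pow_mul, Nat.mul_div_cancel' (h c (mem_words.1 hc))]

theorem coeff_halfEnum {n : ℕ} {C : Code n} (h : ∀ x ∈ C, 2 ∣ hammingNorm x) (k : ℕ) :
    (halfEnum C).coeff k = (wordsOfWeight C (2 * k)).card := by
  have := coeff_expand_mul' (R := ℝ) (p := 2) (by norm_num) (halfEnum C) k
  rw [expand_halfEnum h, coeff_enum] at this
  rw [← this]
  simp

/-- The invariants of Gleason's theorem in the variable `z = y²`. -/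
noncomputable def gleason (m j : ℕ) : ℝ[X] := (1 + X) ^ (4 * m - 4 * j) * (X * (1 - X) ^ 2) ^ j

theorem coeff_symm {N : ℕ} {P : ℝ[X]} (hd : P.natDegree ≤ N)
    (h : ∀ y : ℝ, 0 < y → y < 1 → y ^ N * P.eval (1 / y) = P.eval y) {k : ℕ} (hk : k ≤ N) :
    P.coeff k = P.coeff (N - k) := by
  have : reflect N P = P := by
    refine eq_of_eval_eq_Ioo fun y h0 h1 => ?_
    have hy : (1 / y) ≠ 0 := by positivity
    let _ := invertibleOfNonzero hy
    have := eval₂_reflect_mul_pow (RingHom.id ℝ) (1 / y) N P hd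
    simp only [invOf_eq_inv, one_div, inv_inv, eval₂_id] at this
    rw [← h y h0 h1, one_div, ← this, inv_pow]
    field_simp
  have e := congrArg (fun Q => Q.coeff k) this
  simp only [coeff_reflect, revAt_le hk] at e
  exact e.symm

theorem natDegree_gleason_le {m j : ℕ} (hj : j ≤ m) : (gleason m j).natDegree ≤ 4 * m := by
  have h1 : (1 + X : ℝ[X]).natDegree ≤ 1 := by compute_degree
  have h2 : (X * (1 - X) ^ 2 : ℝ[X]).natDegree ≤ 3 := by compute_degree
  refine natDegree_mul_le.trans ?_
  have a := natDegree_pow_le_of_le (4 * m - 4 * j) h1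
  have b := natDegree_pow_le_of_le j h2
  omega

theorem gleason_reciprocal {m j : ℕ} (hj : j ≤ m) {y : ℝ} (hy : 0 < y) :
    y ^ (4 * m) * (gleason m j).eval (1 / y) = (gleason m j).eval y := by
  obtain ⟨r, rfl⟩ := Nat.exists_eq_add_of_le hj
  simp only [gleason, eval_mul, eval_pow, eval_add, eval_sub, eval_one, eval_X]
  rw [show 4 * (j + r) - 4 * j = 4 * r by omega, mul_add, pow_add, pow_mul y 4 j, pow_mul y 4 r,
    pow_mul _ 4 r, pow_mul _ 4 r]
  have e1 : y ^ 4 * (1 + 1 / y) ^ 4 = (1 + y) ^ 4 := by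
    rw [← mul_pow]; congr 1; field_simp; ring
  have e2 : y ^ 4 * (1 / y * (1 - 1 / y) ^ 2) = y * (1 - y) ^ 2 := by
    field_simp; ring
  rw [← e1, ← e2]
  simp only [mul_pow (y ^ 4)]
  generalize (1 + 1 / y) ^ 4 = A
  generalize 1 / y * (1 - 1 / y) ^ 2 = B
  ring

/-- Both 1+y² and y²(1-y²)² are reproduced by y ↦ (1-y)/(1+y), up to powers of 2 and of 1+y. -/
theorem gleason_transform {m j : ℕ} (hj : j ≤ m) {y : ℝ} (hy : 0 < y) :
    2 ^ (4 * m) * (gleason m j).eval (y ^ 2) =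
      (1 + y) ^ (8 * m) * (gleason m j).eval (((1 - y) / (1 + y)) ^ 2) := by
  obtain ⟨r, rfl⟩ := Nat.exists_eq_add_of_le hj
  have hp : 1 + y ≠ 0 := by positivity
  simp only [gleason, eval_mul, eval_pow, eval_add, eval_sub, eval_one, eval_X]
  rw [show 4 * (j + r) - 4 * j = 4 * r by omega]
  have e1 : (1 + y) ^ 2 * (1 + ((1 - y) / (1 + y)) ^ 2) = 2 * (1 + y ^ 2) := by
    field_simp; ring
  have e2 : (1 + y) ^ 8 * (((1 - y) / (1 + y)) ^ 2 * (1 - ((1 - y) / (1 + y)) ^ 2) ^ 2) =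
      2 ^ 4 * (y ^ 2 * (1 - y ^ 2) ^ 2) := by
    field_simp; ring
  have f1 := congrArg (· ^ (4 * r)) e1
  have f2 := congrArg (· ^ j) e2
  simp only [mul_pow _ _ (4 * r), mul_pow _ _ j, ← pow_mul] at f1 f2
  rw [show 8 * (j + r) = 8 * j + 2 * (4 * r) by ring, show 4 * (j + r) = 4 * j + 4 * r by ring,
    pow_add, pow_add]
  simp only [mul_pow _ _ j, ← pow_mul]
  linear_combination
    (-f2) * ((1 + y) ^ (2 * (4 * r)) * (1 + ((1 - y) / (1 + y)) ^ 2) ^ (4 * r)) -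
    f1 * (2 ^ (4 * j) * (y ^ (2 * j) * (1 - y ^ 2) ^ (2 * j)))

theorem card_wordsOfWeight_compl {n : ℕ} {C : Code n} (h1 : (1 : Fin n → ZMod 2) ∈ C) {w : ℕ}
    (hw : w ≤ n) : (wordsOfWeight C w).card = (wordsOfWeight C (n - w)).card := by
  have h2 : ∀ x : Fin n → ZMod 2, 1 + (1 + x) = x := by
    intro x; ext i; simp only [Pi.add_apply, Pi.one_apply]; generalize x i = a; revert a; decide
  refine Finset.card_bij' (fun x _ => 1 + x) (fun x _ => 1 + x) ?_ ?_ (fun x _ => h2 x)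
    (fun x _ => h2 x)
  all_goals
    intro x hx
    obtain ⟨hx, hxw⟩ := mem_wordsOfWeight.1 hx
    refine mem_wordsOfWeight.2 ⟨C.add_mem h1 hx, ?_⟩
    have := hammingNorm_one_sub x
    omega

/-- A near-extremal Type I code has the weight enumerator determined by Gleason's theorem and the
vanishing of the number of shadow vectors of weight zero. -/
theorem halfEnum_eq {m : ℕ} (hm : 1 ≤ m) {C : Code (8 * m)} (hI : IsTypeI C) (hC : IsBalanced C)
    {f : ℝ[X]} {a : ℕ → ℝ} (hf : f = ∑ j ∈ Finset.range m, Polynomial.C (a j) * gleason m j)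
    (h1 : X ^ m ∣ f - 1) : halfEnum C = f := by
  have hfd : f.natDegree ≤ 4 * m := by
    rw [hf]
    refine natDegree_sum_le_of_forall_le _ _ fun j hj => ?_
    exact (natDegree_C_mul_le _ _).trans (natDegree_gleason_le (Finset.mem_range.1 hj).le)
  have hfr : ∀ y : ℝ, 0 < y → y < 1 → y ^ (4 * m) * f.eval (1 / y) = f.eval y := by
    intro y h0 _
    rw [hf, eval_finsetSum, eval_finsetSum, Finset.mul_sum]
    refine Finset.sum_congr rfl fun j hj => ?_
    rw [eval_mul, eval_mul, eval_C, eval_C, ← gleason_reciprocal (Finset.mem_range.1 hj).le h0]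
    ring
  have hft : ∀ y : ℝ, 0 < y → 2 ^ (4 * m) * f.eval (y ^ 2) =
      (1 + y) ^ (8 * m) * f.eval (((1 - y) / (1 + y)) ^ 2) := by
    intro y h0
    rw [hf, eval_finsetSum, eval_finsetSum, Finset.mul_sum, Finset.mul_sum]
    refine Finset.sum_congr rfl fun j hj => ?_
    rw [eval_mul, eval_mul, eval_C, eval_C]
    linear_combination a j * gleason_transform (Finset.mem_range.1 hj).le h0
  have hlow : ∀ k < m, (halfEnum C - f).coeff k = 0 := by
    intro k hk
    have e1 := X_pow_dvd_iff.1 h1 k hk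
    have e2 : (halfEnum C).coeff k = (1 : ℝ[X]).coeff k := by
      rw [coeff_halfEnum hC.even, coeff_one]
      by_cases hk0 : k = 0
      · have : wordsOfWeight C (2 * k) = {0} := by
          ext x
          simp only [mem_wordsOfWeight, hk0, mul_zero, hammingNorm_eq_zero, Finset.mem_singleton]
          exact ⟨fun h => h.2, fun h => ⟨h ▸ C.zero_mem, h⟩⟩
        rw [this]
        simp [hk0]
      · rw [if_neg hk0, Nat.cast_eq_zero, Finset.card_eq_zero, Finset.eq_empty_iff_forall_notMem]
        intro x hx
        obtain ⟨hx, hxw⟩ := mem_wordsOfWeight.1 hx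
        have := hC.le_weight x hx fun h0 => by
          rw [h0, hammingNorm_zero] at hxw
          omega
        omega
    rw [coeff_sub] at e1 ⊢
    linarith
  have hsymm : ∀ k ≤ 4 * m, (halfEnum C - f).coeff k = (halfEnum C - f).coeff (4 * m - k) := by
    intro k hk
    rw [coeff_sub, coeff_sub, coeff_symm hfd hfr hk, coeff_halfEnum hC.even,
      coeff_halfEnum hC.even, card_wordsOfWeight_compl hC.one_mem (by omega)]
    congr 4
    omega
  have hhigh : ∀ k, 4 * m < k → (halfEnum C - f).coeff k = 0 := by
    intro k hk
    rw [coeff_sub, coeff_eq_zero_of_natDegree_lt (lt_of_le_of_lt hfd hk), sub_zero,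
      coeff_halfEnum hC.even, Nat.cast_eq_zero, Finset.card_eq_zero,
      Finset.eq_empty_iff_forall_notMem]
    intro x hx
    have := (mem_wordsOfWeight.1 hx).2
    have := hammingNorm_le x
    omega
  -- With e = 0 the cofactor is constant, so the difference is a multiple of the one invariant
  -- absent from f, `gleason m m` = X^m (1-X)^(2m).
  obtain ⟨Q, hQ, hdeg, -, -⟩ := exists_factor (m := m) (e := 0) (Z := expand ℝ 2 (halfEnum C - f))
    (by omega)
    (by
      intro w hw
      rw [coeff_expand (by norm_num)] at hw
      split_ifs at hw with h2
      · obtain ⟨k, rfl⟩ := h2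
        rw [Nat.mul_div_cancel_left _ (by norm_num)] at hw
        have c1 : ¬ k < m := fun h => hw (hlow k h)
        have c2 : ¬ 4 * m < k := fun h => hw (hhigh k h)
        have c3 : ¬ 4 * m - k < m := fun h => hw (by rw [hsymm k (by omega), hlow _ h])
        exact ⟨⟨k, rfl⟩, by omega, by omega⟩
      · exact absurd rfl hw)
    (by
      intro y h0 h1
      have hA := macWilliams C h0 h1
      rw [hI.1, hC.card_eq] at hA
      push_cast at hA
      rw [map_sub, expand_halfEnum hC.even, eval_sub, eval_sub, expand_eval, expand_eval]
      linear_combination hA - hft y h0)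
  obtain ⟨α, rfl⟩ : ∃ α, Q = Polynomial.C α := ⟨_, eq_C_of_natDegree_le_zero (by simpa using hdeg)⟩
  have hh : halfEnum C - f = Polynomial.C α * (X ^ m * (1 - X) ^ (2 * m)) := by
    refine expand_injective (R := ℝ) (n := 2) (by norm_num) ?_
    rw [hQ]
    simp only [map_mul, map_pow, map_sub, expand_X, map_one, expand_C, ← pow_mul]
    rw [Nat.sub_zero]
    ring
  -- At -1 the invariants with j < m vanish through their factor 1+X, and `halfEnum C` vanishes by
  -- the Type I condition, but X^m (1-X)^(2m) does not.
  have h0 := congrArg (eval (-1)) hh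
  have hf0 : f.eval (-1) = 0 := by
    rw [hf, eval_finsetSum]
    refine Finset.sum_eq_zero fun j hj => ?_
    have : 4 * m - 4 * j ≠ 0 := by have := Finset.mem_range.1 hj; omega
    simp [gleason, this]
  have hA0 : (halfEnum C).eval (-1) = 0 := by
    rw [halfEnum, eval_finsetSum]
    simpa using sum_neg_one_pow hI
  rw [eval_sub, hf0, hA0] at h0
  simp only [eval_mul, eval_C, eval_pow, eval_X, eval_sub, eval_one, sub_zero] at h0
  have hα : α = 0 := by
    rcases mul_eq_zero.1 h0.symm with h | h
    · exact h
    · exact absurd h (mul_ne_zero (pow_ne_zero _ (by norm_num)) (pow_ne_zero _ (by norm_num)))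
  rw [hα, map_zero, zero_mul] at hh
  exact sub_eq_zero.1 hh

/-! ### Short lengths -/

/-- The coefficient extraction from `halfEnum_eq`. -/
theorem card_wordsOfWeight_eq {m : ℕ} (hm : 1 ≤ m) {C : Code (8 * m)} (hI : IsTypeI C)
    (hC : IsBalanced C) {f g : ℝ[X]} {a : ℕ → ℝ}
    (hf : f = ∑ j ∈ Finset.range m, Polynomial.C (a j) * gleason m j)
    (h1 : f - 1 = X ^ m * g) (k : ℕ) :
    ((wordsOfWeight C (2 * (m + k))).card : ℝ) = g.coeff k := by
  have h : (1 : ℝ[X]).coeff (m + k) = 0 := by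
    rw [coeff_one, if_neg (by omega)]
  rw [← coeff_halfEnum hC.even, halfEnum_eq hm hI hC hf ⟨g, h1⟩, ← sub_zero (f.coeff _), ← h,
    ← coeff_sub, h1, add_comm m k, coeff_X_pow_mul]

theorem card_min_one {C : Code (8 * 1)} (hI : IsTypeI C) (hC : IsBalanced C) :
    (wordsOfWeight C 2).card = 4 := by
  have := card_wordsOfWeight_eq (by norm_num) hI hC (a := fun _ => 1)
    (g := 4 + X * (6 + 4 * X + X ^ 2)) rfl (by
      simp only [Finset.sum_range_succ, Finset.sum_range_zero, gleason, map_one]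
      ring) 0
  simp at this
  exact_mod_cast this

theorem card_two {C : Code (8 * 2)} (hI : IsTypeI C) (hC : IsBalanced C) (k : ℕ) :
    ((wordsOfWeight C (2 * (2 + k))).card : ℝ) =
      (12 + 64 * X + 102 * X ^ 2 + 64 * X ^ 3 + 12 * X ^ 4 + X ^ 6 : ℝ[X]).coeff k := by
  -- The coefficients `a`, here and for the other lengths, are those that cancel X, ..., X^(m-1) in
  -- f.
  refine card_wordsOfWeight_eq (by norm_num) hI hC (a := fun j => if j = 0 then 1 else -8)
    rfl ?_ k
  simp only [Finset.sum_range_succ, Finset.sum_range_zero, gleason]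
  simp only [if_true, if_neg one_ne_zero, map_one, map_neg, map_ofNat]
  ring

theorem card_two_four {C : Code (8 * 2)} (hI : IsTypeI C) (hC : IsBalanced C) :
    (wordsOfWeight C 4).card = 12 := by
  have := card_two hI hC 0
  simp at this
  exact_mod_cast this

theorem card_two_six {C : Code (8 * 2)} (hI : IsTypeI C) (hC : IsBalanced C) :
    (wordsOfWeight C 6).card = 64 := by
  have := card_two hI hC 1
  simp [coeff_X_pow, coeff_ofNat_mul, coeff_X] at this
  exact_mod_cast this

theorem card_min_three {C : Code (8 * 3)} (hI : IsTypeI C) (hC : IsBalanced C) :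
    (wordsOfWeight C 6).card = 64 := by
  have := card_wordsOfWeight_eq (by norm_num) hI hC
    (a := fun j => if j = 0 then 1 else if j = 1 then -12 else 6)
    (g := 64 + X * (375 + 960 * X + 1296 * X ^ 2 + 960 * X ^ 3 + 375 * X ^ 4 + 64 * X ^ 5
      + X ^ 8)) rfl (by
      simp only [Finset.sum_range_succ, Finset.sum_range_zero, gleason]
      simp only [if_true, if_neg one_ne_zero, if_neg two_ne_zero,
        if_neg (by norm_num : (2 : ℕ) ≠ 1),
        map_one, map_neg, map_ofNat]
      ring) 0
  simp at this
  exact_mod_cast this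

theorem card_min_four {C : Code (8 * 4)} (hI : IsTypeI C) (hC : IsBalanced C) :
    (wordsOfWeight C 8).card = 364 := by
  have := card_wordsOfWeight_eq (by norm_num) hI hC
    (a := fun j => if j = 0 then 1 else if j = 1 then -16 else if j = 2 then 40 else -32)
    (g := 364 + X * (2048 + 6720 * X + 14336 * X ^ 2 + 18598 * X ^ 3 + 14336 * X ^ 4
      + 6720 * X ^ 5 + 2048 * X ^ 6 + 364 * X ^ 7 + X ^ 11)) rfl (by
      simp only [Finset.sum_range_succ, Finset.sum_range_zero, gleason]
      simp only [if_true, if_neg one_ne_zero, if_neg two_ne_zero,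
        if_neg (by norm_num : (2 : ℕ) ≠ 1),
        if_neg (by norm_num : (3 : ℕ) ≠ 0), if_neg (by norm_num : (3 : ℕ) ≠ 1),
        if_neg (by norm_num : (3 : ℕ) ≠ 2), map_one, map_neg, map_ofNat]
      ring) 0
  rw [coeff_zero_eq_eval_zero] at this
  simp only [eval_add, eval_mul, eval_X, eval_ofNat, zero_mul, add_zero] at this
  exact_mod_cast this

/-- The words of minimum weight do not form a `2`-design. -/
theorem not_isSupportDesign_min {m : ℕ} (hm : 1 ≤ m) (hm4 : m ≤ 4) {C : Code (8 * m)}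
    (hI : IsTypeI C) (hC : IsBalanced C) : ¬ IsSupportDesign C (2 * m) 2 := by
  rintro ⟨l, hl⟩
  have h := hl.card_two_mul
  rw [card_blocks] at h
  -- Here 2m(2m-1)|C_(2m)| is 8, 144, 1920, 20384, never a multiple of 8m(8m-1) = 56, 240, 552, 992.
  interval_cases m
  · rw [card_min_one hI hC] at h
    omega
  · rw [card_two_four hI hC] at h
    omega
  · rw [card_min_three hI hC] at h
    omega
  · rw [card_min_four hI hC] at h
    omega

end SupportDesign

namespace SupportDesign
open scoped Classical

/-! ### Lagrange inversion for the Gleason coefficients -/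

section Lagrange

open PowerSeries

/-- This replaces the vanishing of the residue of a derivative, which avoids Laurent series. -/
theorem coeff_mul_sub_X_mul_derivative (A : ℝ⟦X⟧) (k : ℕ) :
    coeff k ((k : ℝ⟦X⟧) * A - X * d⁄dX ℝ A) = 0 := by
  rw [map_sub, ← map_natCast (C : ℝ →+* ℝ⟦X⟧), coeff_C_mul]
  cases k with
  | zero => simp
  | succ k =>
    rw [coeff_succ_X_mul, coeff_derivative]
    push_cast
    ring

/-- `L` is the logarithmic derivative of `A`. -/
def HasLogDeriv (A L : ℝ⟦X⟧) : Prop := d⁄dX ℝ A = A * L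

theorem HasLogDeriv.mul {A B L M : ℝ⟦X⟧} (hA : HasLogDeriv A L) (hB : HasLogDeriv B M) :
    HasLogDeriv (A * B) (L + M) := by
  unfold HasLogDeriv at *
  rw [Derivation.leibniz, hA, hB, smul_eq_mul, smul_eq_mul]
  ring

theorem HasLogDeriv.pow {A L : ℝ⟦X⟧} (hA : HasLogDeriv A L) (n : ℕ) :
    HasLogDeriv (A ^ n) (n * L) := by
  induction n with
  | zero => simp [HasLogDeriv]
  | succ n ih =>
    have := ih.mul hA
    rw [pow_succ]
    convert this using 1
    push_cast
    ring

variable {D E : ℝ⟦X⟧}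

theorem hasLogDeriv_one_add (hE : E * (1 + X) = 1) : HasLogDeriv (1 + X) E := by
  unfold HasLogDeriv
  rw [mul_comm, hE]
  simp

theorem hasLogDeriv_inv_one_add (hE : E * (1 + X) = 1) : HasLogDeriv E (-E) := by
  have h := congrArg (d⁄dX ℝ) hE
  rw [Derivation.leibniz] at h
  simp only [map_add, derivative_X, smul_eq_mul, Derivation.map_one_eq_zero, zero_add, mul_one] at h
  unfold HasLogDeriv
  linear_combination E * h - (d⁄dX ℝ E) * hE

theorem hasLogDeriv_inv_one_sub (hD : D * (1 - X) = 1) : HasLogDeriv D D := by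
  have h := congrArg (d⁄dX ℝ) hD
  rw [Derivation.leibniz] at h
  simp only [map_sub, derivative_X, smul_eq_mul, Derivation.map_one_eq_zero, zero_sub, mul_neg,
    mul_one] at h
  unfold HasLogDeriv
  linear_combination D * h - (d⁄dX ℝ D) * hD

/-- The generating function whose coefficients appear in the inversion. -/
theorem mul_sub_X_mul_derivative (hD : D * (1 - X) = 1) (hE : E * (1 + X) = 1) (k : ℕ) :
    (k : ℝ⟦X⟧) * ((1 + X) ^ (4 * k) * D ^ (2 * k)) - X * d⁄dX ℝ ((1 + X) ^ (4 * k) * D ^ (2 * k)) =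
      (k : ℝ⟦X⟧) * ((1 + X) ^ (4 * k) * D ^ (2 * k) * (E * D * (1 - 6 * X + X ^ 2))) := by
  have h : HasLogDeriv ((1 + X) ^ (4 * k) * D ^ (2 * k)) _ :=
    ((hasLogDeriv_one_add hE).pow (4 * k)).mul ((hasLogDeriv_inv_one_sub hD).pow (2 * k))
  rw [h]
  generalize (1 + X) ^ (4 * k) * D ^ (2 * k) = g
  push_cast
  have e : E * D * (1 - 6 * X + X ^ 2) = 1 - 4 * X * E - 2 * X * D := by
    linear_combination (D * (1 - X) - 2 * X * D) * hE + (1 - 4 * X * E) * hD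
  rw [e]
  ring

/-- Put φ = X(1-X)²/(1+X)^4. Then (1+X)^(4k) D^(2k) = (X/φ)^k and E D (1-6X+X²) = Xφ'/φ, so this is
the residue of φ'/φ^(k+1). -/
theorem coeff_lagrange_kernel (hD : D * (1 - X) = 1) (hE : E * (1 + X) = 1) (k : ℕ) :
    coeff k ((1 + X) ^ (4 * k) * D ^ (2 * k) * (E * D * (1 - 6 * X + X ^ 2))) =
      if k = 0 then 1 else 0 := by
  split_ifs with hk
  · subst hk
    have h1 := congrArg constantCoeff hD
    have h2 := congrArg constantCoeff hE
    simp at h1 h2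
    simp [h1, h2]
  · have h := congrArg (coeff k) (mul_sub_X_mul_derivative hD hE k)
    rw [coeff_mul_sub_X_mul_derivative, ← map_natCast (C : ℝ →+* ℝ⟦X⟧) k, coeff_C_mul] at h
    exact (mul_eq_zero.1 h.symm).resolve_left (Nat.cast_ne_zero.2 hk)

/-- Division by (1+X)^(4k+8) turns the hypothesis into the expansion of (1+X)^(-4k-8) in powers of φ
modulo X^(k+2); the conclusion is the Lagrange-Bürmann formula for φ^(k+1). Here m = k+2. -/
theorem lagrange_inversion (hD : D * (1 - X) = 1) (hE : E * (1 + X) = 1) {k : ℕ} {a : ℕ → ℝ}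
    {R : ℝ⟦X⟧}
    (h : ∑ j ∈ Finset.range (k + 2),
      C (a j) * ((1 + X) ^ (4 * (k + 2) - 4 * j) * (X * (1 - X) ^ 2) ^ j) = 1 + X ^ (k + 2) * R) :
    ((k : ℝ) + 1) * a (k + 1) = -(4 * k + 8) * coeff k (E ^ 5 * D ^ (2 * (k + 1))) := by
  set S : ℝ⟦X⟧ := E ^ 5 * D ^ (2 * (k + 1) + 1) * (1 - 6 * X + X ^ 2) with hS
  -- Multiplication by S turns the j-th term into X^j times the kernel of index k+1-j, so only j =
  -- k+1 survives.
  have hterm : ∀ j ∈ Finset.range (k + 2),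
      coeff (k + 1) (C (a j) * ((1 + X) ^ (4 * (k + 2) - 4 * j) * (X * (1 - X) ^ 2) ^ j) * S) =
        if j = k + 1 then a j else 0 := by
    intro j hj
    have hj' : j ≤ k + 1 := Nat.lt_succ_iff.1 (Finset.mem_range.1 hj)
    obtain ⟨i, hi⟩ := Nat.exists_eq_add_of_le hj'
    have e : (1 + X) ^ (4 * (k + 2) - 4 * j) * (X * (1 - X) ^ 2) ^ j * S =
        X ^ j * ((1 + X) ^ (4 * i) * D ^ (2 * i) * (E * D * (1 - 6 * X + X ^ 2))) := by
      have h1 : (E * (1 + X)) ^ 4 * (D * (1 - X)) ^ (2 * j) = 1 := by rw [hD, hE]; simp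
      rw [hS, show 4 * (k + 2) - 4 * j = 4 * i + 4 by omega, hi]
      calc _ = X ^ j * ((1 + X) ^ (4 * i) * D ^ (2 * i) * (E * D * (1 - 6 * X + X ^ 2))) *
            ((E * (1 + X)) ^ 4 * (D * (1 - X)) ^ (2 * j)) := by
            generalize (1 + X : ℝ⟦X⟧) = A
            generalize (1 - X : ℝ⟦X⟧) = B
            ring
        _ = _ := by rw [h1, mul_one]
    rw [mul_assoc, coeff_C_mul, e, coeff_X_pow_mul', if_pos hj', show k + 1 - j = i by omega,
      coeff_lagrange_kernel hD hE]
    by_cases hi0 : i = 0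
    · rw [if_pos hi0, if_pos (by omega), mul_one]
    · rw [if_neg hi0, if_neg (by omega), mul_zero]
  have hcoeff : a (k + 1) = coeff (k + 1) S := by
    have h1 := congrArg (fun P => coeff (k + 1) (P * S)) h
    simp only [Finset.sum_mul, map_sum] at h1
    rw [Finset.sum_congr rfl hterm, Finset.sum_ite_eq' (Finset.range (k + 2)) (k + 1) a,
      if_pos (by simp), add_mul, one_mul, mul_assoc, map_add, coeff_X_pow_mul',
      if_neg (by omega), add_zero] at h1
    exact h1
  have hone : (E * (1 + X)) ^ (4 * (k + 1)) = 1 := by rw [hE, one_pow]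
  set g : ℝ⟦X⟧ := (1 + X) ^ (4 * (k + 1)) * D ^ (2 * (k + 1)) with hg
  set H : ℝ⟦X⟧ := E ^ (4 * (k + 1) + 4) with hH
  have hSg : S = H * (g * (E * D * (1 - 6 * X + X ^ 2))) := by
    calc S = S * (E * (1 + X)) ^ (4 * (k + 1)) := by rw [hone, mul_one]
      _ = _ := by rw [hS, hH, hg]; generalize (1 + X : ℝ⟦X⟧) = A; ring
  have hlog : d⁄dX ℝ H = H * (((4 * (k + 1) + 4 : ℕ) : ℝ⟦X⟧) * -E) :=
    (hasLogDeriv_inv_one_add hE).pow _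
  have hEHg : E * H * g = E ^ 5 * D ^ (2 * (k + 1)) := by
    calc _ = E ^ 5 * D ^ (2 * (k + 1)) * (E * (1 + X)) ^ (4 * (k + 1)) := by
          rw [hH, hg]; generalize (1 + X : ℝ⟦X⟧) = A; ring
      _ = _ := by rw [hone, mul_one]
  -- Integration by parts: the derivative moves from g to H, up to a part with zero coefficient at
  -- k+1.
  have hmain : ((k + 1 : ℕ) : ℝ⟦X⟧) * S =
      (((k + 1 : ℕ) : ℝ⟦X⟧) * (H * g) - X * d⁄dX ℝ (H * g)) -
        ((4 * (k + 1) + 4 : ℕ) : ℝ⟦X⟧) * (X * (E ^ 5 * D ^ (2 * (k + 1)))) := by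
    have h1 := mul_sub_X_mul_derivative hD hE (k + 1)
    rw [← hg] at h1
    rw [hSg, Derivation.leibniz, smul_eq_mul, smul_eq_mul, hlog, ← hEHg]
    linear_combination (-H) * h1
  have h2 := congrArg (coeff (k + 1)) hmain
  rw [map_sub (coeff (k + 1)), coeff_mul_sub_X_mul_derivative,
    ← map_natCast (C : ℝ →+* ℝ⟦X⟧) (k + 1), ← map_natCast (C : ℝ →+* ℝ⟦X⟧) (4 * (k + 1) + 4),
    coeff_C_mul, coeff_C_mul, coeff_succ_X_mul, ← hcoeff] at h2
  push_cast at h2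
  linear_combination h2

theorem le_coeff_mul {A B : ℝ⟦X⟧} (hA : ∀ n, 0 ≤ coeff n A) (hA0 : coeff 0 A = 1)
    (hB : ∀ n, 0 ≤ coeff n B) (n : ℕ) : coeff n B ≤ coeff n (A * B) := by
  rw [coeff_mul]
  refine le_trans (le_of_eq ?_) (Finset.single_le_sum (f := fun p => coeff p.1 A * coeff p.2 B)
    (fun p _ => mul_nonneg (hA _) (hB _)) (show (0, n) ∈ _ by simp))
  simp [hA0]

theorem coeff_nonneg_of_mul_one_sub_X_sq {P : ℝ⟦X⟧} (h : P * (1 - X ^ 2) = 1) (n : ℕ) :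
    0 ≤ coeff n P := by
  have hP : P = 1 + P * X ^ 2 := by linear_combination h
  induction n using Nat.strong_induction_on with
  | _ n ih =>
    rw [hP, map_add, coeff_mul_X_pow', coeff_one]
    refine add_nonneg (by split_ifs <;> norm_num) ?_
    split_ifs with h2
    · exact ih _ (by omega)
    · exact le_rfl

/-- The series is (E D)^5 D^(2k+3), and E D = 1/(1-X²) has nonnegative coefficients and constant
term 1, so dropping (E D)^5 can only decrease coefficients. -/
theorem choose_le_coeff (hD : D * (1 - X) = 1) (hE : E * (1 + X) = 1) (k : ℕ) :
    ((3 * k + 5).choose (2 * k + 2) : ℝ) ≤ coeff (k + 3) (E ^ 5 * D ^ (2 * (k + 3 + 1))) := by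
  have hP : E * D * (1 - X ^ 2) = 1 := by
    calc E * D * (1 - X ^ 2) = (E * (1 + X)) * (D * (1 - X)) := by ring
      _ = 1 := by rw [hD, hE, one_mul]
  have hDmk : D = PowerSeries.mk 1 := by
    have := mk_one_mul_one_sub_eq_one ℝ
    calc D = D * (PowerSeries.mk 1 * (1 - X)) := by rw [this, mul_one]
      _ = PowerSeries.mk 1 * (D * (1 - X)) := by ring
      _ = _ := by rw [hD, mul_one]
  have hF : ∀ n, coeff n (D ^ (2 * k + 2 + 1)) = ((2 * k + 2 + n).choose (2 * k + 2) : ℝ) := by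
    intro n
    rw [hDmk, mk_one_pow_eq_mk_choose_add, coeff_mk]
  have h0 := coeff_nonneg_of_mul_one_sub_X_sq hP
  have h1 : coeff 0 (E * D) = 1 := by
    have := congrArg (coeff 0) hP
    simpa using this
  have step : ∀ (r : ℕ) (n : ℕ), ((2 * k + 2 + n).choose (2 * k + 2) : ℝ) ≤
      coeff n ((E * D) ^ r * D ^ (2 * k + 2 + 1)) := by
    intro r
    induction r with
    | zero => intro n; rw [pow_zero, one_mul, hF]
    | succ r ih =>
      intro n
      rw [pow_succ', mul_assoc]
      exact (ih n).trans (le_coeff_mul h0 h1 (fun n => (Nat.cast_nonneg _).trans (ih n)) n)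
  have := step 5 (k + 3)
  rw [show E ^ 5 * D ^ (2 * (k + 3 + 1)) = (E * D) ^ 5 * D ^ (2 * k + 2 + 1) by ring]
  refine le_trans (le_of_eq ?_) this
  congr 2
  omega

/-- Three Pascal steps write the next coefficient as C(N,r-2) + 3C(N,r-1) + 3C(N,r) + C(N,r+1) with
r = k+3; below the middle the last two terms already reach 4C(N,r). -/
theorem four_pow_lt_choose (k : ℕ) : 4 ^ (k + 1) < (3 * k + 5).choose (k + 3) := by
  induction k with
  | zero => decide
  | succ k ih =>
    rcases Nat.lt_or_ge k 3 with hk | hk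
    · interval_cases k <;> decide
    · have h1 : (3 * k + 5).choose (k + 3) ≤ (3 * k + 5).choose (k + 3 + 1) :=
        Nat.choose_le_succ_of_lt_half_left (by omega)
      have e : (3 * (k + 1) + 5).choose (k + 1 + 3) =
          (3 * k + 5).choose (k + 1) + 3 * (3 * k + 5).choose (k + 2) +
            3 * (3 * k + 5).choose (k + 3) + (3 * k + 5).choose (k + 3 + 1) := by
        rw [show 3 * (k + 1) + 5 = 3 * k + 5 + 1 + 1 + 1 by ring,
          show k + 1 + 3 = k + 1 + 1 + 1 + 1 by ring]
        simp only [Nat.choose_succ_succ]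
        ring
      rw [e, pow_succ]
      omega

end Lagrange

open Polynomial

/-! ### Nonexistence of long near-extremal Type I codes -/

/-- The invariant of index j begins with X^j, coefficient one, so the conditions on `a` are
triangular. -/
theorem exists_gleason {m : ℕ} (k : ℕ) : ∃ a : ℕ → ℝ,
    X ^ k ∣ ∑ j ∈ Finset.range k, Polynomial.C (a j) * gleason m j - 1 := by
  induction k with
  | zero => exact ⟨0, by simp⟩
  | succ k ih =>
    obtain ⟨a, R, hR⟩ := ih
    refine ⟨fun j => if j = k then -R.coeff 0 else a j, ?_⟩
    have e : ∑ j ∈ Finset.range k, Polynomial.C (if j = k then -R.coeff 0 else a j) * gleason m j =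
        ∑ j ∈ Finset.range k, Polynomial.C (a j) * gleason m j :=
      Finset.sum_congr rfl fun j hj => by rw [if_neg (Finset.mem_range.1 hj).ne]
    have h : (X : ℝ[X]) ∣ R - Polynomial.C (R.coeff 0) *
        ((1 + X) ^ (4 * m - 4 * k) * ((1 - X) ^ 2) ^ k) := by
      rw [X_dvd_iff, coeff_zero_eq_eval_zero]
      simp [coeff_zero_eq_eval_zero]
    obtain ⟨Q, hQ⟩ := h
    refine ⟨Q, ?_⟩
    simp only [Finset.sum_range_succ, e, if_true]
    rw [gleason, pow_succ X k, mul_assoc, ← hQ, map_neg, mul_pow]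
    linear_combination hR

/-- The power y^(4(m-j)) isolates the last index: with j < m, only j = m-1 contributes to weight
four of the shadow. -/
theorem gleason_shadow {m j : ℕ} (hj : j ≤ m) {y : ℝ} (hy : 0 < y) :
    (1 + y) ^ (8 * m) * (gleason m j).eval (-((1 - y) / (1 + y)) ^ 2) =
      (4 * y) ^ (4 * (m - j)) * (-4 * (1 - y ^ 4) ^ 2) ^ j := by
  obtain ⟨r, rfl⟩ := Nat.exists_eq_add_of_le hj
  have hp : 1 + y ≠ 0 := by positivity
  simp only [gleason, eval_mul, eval_pow, eval_add, eval_sub, eval_one, eval_X]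
  rw [show 4 * (j + r) - 4 * j = 4 * r by omega, Nat.add_sub_cancel_left]
  have e1 : (1 + y) ^ 2 * (1 + -((1 - y) / (1 + y)) ^ 2) = 4 * y := by
    field_simp; ring
  have e2 : (1 + y) ^ 8 * (-((1 - y) / (1 + y)) ^ 2 * (1 - -((1 - y) / (1 + y)) ^ 2) ^ 2) =
      -4 * (1 - y ^ 4) ^ 2 := by
    field_simp; ring
  rw [← e1, ← e2, show 8 * (j + r) = 8 * j + 2 * (4 * r) by ring, pow_add, pow_mul, pow_mul]
  simp only [mul_pow ((1 + y) ^ 8), mul_pow ((1 + y) ^ 2)]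
  generalize 1 + -((1 - y) / (1 + y)) ^ 2 = A
  generalize -((1 - y) / (1 + y)) ^ 2 * (1 - -((1 - y) / (1 + y)) ^ 2) ^ 2 = B
  ring

/-- The weight enumerator of the shadow. -/
theorem eval_shadow {n : ℕ} {C : Code n} (hs : dual C = C) {y : ℝ} (hy : 0 < y) :
    ∑ u : Fin n → ZMod 2, (∑ c ∈ words C, shadowChar u c) * y ^ hammingNorm u =
      (1 + y) ^ n * (halfEnum C).eval (-((1 - y) / (1 + y)) ^ 2) := by
  have hp : 1 + y ≠ 0 := by positivity
  simp_rw [Finset.sum_mul]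
  rw [Finset.sum_comm, halfEnum, eval_finsetSum, Finset.mul_sum]
  refine Finset.sum_congr rfl fun c hc => ?_
  have key := prod_add_sgn (fun _ a => if a = 0 then 1 else y) c
  have e1 : ∀ u : Fin n → ZMod 2, ∏ i, (if u i = 0 then 1 else y) = y ^ hammingNorm u := by
    intro u
    simpa using prod_ite_eq_pow u 1 y
  have e2 : ∏ i, ((if (0 : ZMod 2) = 0 then 1 else y) +
      sgn (c i) * (if (1 : ZMod 2) = 0 then 1 else y)) =
      (1 + y) ^ (n - hammingNorm c) * (1 - y) ^ hammingNorm c := by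
    rw [← prod_ite_eq_pow]
    refine Finset.prod_congr rfl fun i _ => ?_
    rcases zmod_two_cases (c i) with h | h <;> simp [h]
    ring
  rw [e2] at key
  simp only [e1] at key
  have h2 := even_of_self_dual hs (mem_words.1 hc)
  have e3 : (-((1 - y) / (1 + y)) ^ 2) ^ (hammingNorm c / 2) =
      (-1) ^ (hammingNorm c / 2) * ((1 - y) / (1 + y)) ^ hammingNorm c := by
    rw [neg_pow, ← pow_mul, Nat.mul_div_cancel' h2]
  have h : (1 + y) ^ n = (1 + y) ^ (n - hammingNorm c) * (1 + y) ^ hammingNorm c := by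
    rw [← pow_add, Nat.sub_add_cancel (hammingNorm_le c)]
  rw [eval_pow, eval_X, e3, h, div_pow]
  calc _ = (-1) ^ (hammingNorm c / 2) *
        ∑ u : Fin n → ZMod 2, sgn (∑ i, c i * u i) * y ^ hammingNorm u := by
        rw [Finset.mul_sum]
        exact Finset.sum_congr rfl fun u _ => by rw [shadowChar, mul_assoc]
    _ = _ := by
        rw [← key]
        field_simp

/-- There is at most one shadow vector of weight four if the minimum distance exceeds eight. -/
theorem card_shadow_le_one {m : ℕ} (hm : 5 ≤ m) {C : Code (8 * m)} (hs : dual C = C)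
    (hC : IsBalanced C) :
    (Finset.univ.filter fun u : Fin (8 * m) → ZMod 2 =>
      4 = hammingNorm u ∧ ∀ c ∈ C, shadowChar u c = 1).card ≤ 1 := by
  rw [Finset.card_le_one]
  intro u hu v hv
  simp only [Finset.mem_filter, Finset.mem_univ, true_and] at hu hv
  have hmem : u + v ∈ C := by
    rw [← hs]
    intro c hc
    have h := (hu.2 c hc).trans (hv.2 c hc).symm
    have h0 : (-1 : ℝ) ^ (hammingNorm c / 2) ≠ 0 := pow_ne_zero _ (by norm_num)
    have h' := mul_left_cancel₀ h0 h
    simp only [Pi.add_apply, mul_add, Finset.sum_add_distrib]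
    rcases zmod_two_cases (∑ i, c i * u i) with a | a <;>
      rcases zmod_two_cases (∑ i, c i * v i) with b | b <;> rw [a, b] at h' ⊢ <;>
      first | decide | (exfalso; norm_num at h')
  by_contra hne
  have h1 := hC.le_weight _ hmem fun h => hne (by
    ext i
    have := congrFun h i
    simp only [Pi.add_apply, Pi.zero_apply] at this
    exact CharTwo.add_eq_zero.1 this)
  have h2 := hammingNorm_add u v
  omega

/-- Lagrange inversion gives a(m-1) < -4^(m-3). The number N ≤ 1 of shadow vectors of weight four
satisfies 2^(4m) N = a(m-1) 4^4 (-4)^(m-1), so |a(m-1)| ≤ 4^(m-3). -/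
theorem not_isTypeI {m : ℕ} (hm : 5 ≤ m) {C : Code (8 * m)} (hI : IsTypeI C)
    (hC : IsBalanced C) : False := by
  obtain ⟨k, rfl⟩ : ∃ k, m = k + 5 := ⟨m - 5, by omega⟩
  obtain ⟨a, R, hR⟩ := exists_gleason (m := k + 5) (k + 5)
  set f := ∑ j ∈ Finset.range (k + 5), Polynomial.C (a j) * gleason (k + 5) j with hf
  have hA := halfEnum_eq (by omega) hI hC hf ⟨R, hR⟩
  -- the lower bound for the last coefficient
  obtain ⟨D, hD⟩ : ∃ D : PowerSeries ℝ, D * (1 - PowerSeries.X) = 1 :=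
    ⟨_, PowerSeries.mk_one_mul_one_sub_eq_one ℝ⟩
  obtain ⟨E, hE⟩ : ∃ E : PowerSeries ℝ, E * (1 + PowerSeries.X) = 1 :=
    ⟨_, PowerSeries.inv_mul_cancel _ (by simp)⟩
  have hlag := lagrange_inversion hD hE (k := k + 3) (a := a) (R := (R : PowerSeries ℝ)) (by
    have h := congrArg (fun P : ℝ[X] => (P : PowerSeries ℝ)) (eq_add_of_sub_eq' hR)
    simp only [hf, gleason] at h
    have hsum : ∀ (s : Finset ℕ) (F : ℕ → ℝ[X]), ((∑ j ∈ s, F j : ℝ[X]) : PowerSeries ℝ) =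
        ∑ j ∈ s, (F j : PowerSeries ℝ) := fun s F =>
      map_sum (Polynomial.coeToPowerSeries.ringHom (R := ℝ)) F s
    rw [hsum] at h
    simp only [coe_add, coe_mul, coe_sub, coe_pow, coe_one, coe_X, coe_C] at h
    exact h)
  have hch := choose_le_coeff hD hE k
  have hfour : (4 : ℝ) ^ (k + 1) < (3 * k + 5).choose (2 * k + 2) := by
    have := four_pow_lt_choose k
    rw [← Nat.choose_symm_of_eq_add (show 3 * k + 5 = (2 * k + 2) + (k + 3) by ring)] at this
    exact_mod_cast this
  have hlow : a (k + 4) < -4 ^ (k + 2) := by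
    push_cast at hlag
    have hk : (0 : ℝ) ≤ k := Nat.cast_nonneg k
    have hc := lt_of_lt_of_le hfour hch
    set c := PowerSeries.coeff (k + 3) (E ^ 5 * D ^ (2 * (k + 3 + 1))) with hcdef
    have e : (4 : ℝ) ^ (k + 2) = 4 * 4 ^ (k + 1) := by rw [pow_succ']
    rw [e]
    have hpow : (0 : ℝ) < 4 ^ (k + 1) := by positivity
    have hlag' : ((k : ℝ) + 4) * a (k + 4) = -(4 * k + 20) * c := by
      rw [show k + 4 = k + 3 + 1 by ring]
      linear_combination hlag
    by_contra hcon
    push Not at hcon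
    nlinarith
  -- the upper bound from the shadow
  have hpoly : ∑ u : Fin (8 * (k + 5)) → ZMod 2,
      Polynomial.C (∑ c ∈ words C, shadowChar u c) * X ^ hammingNorm u =
      ∑ j ∈ Finset.range (k + 5), Polynomial.C (a j) *
        ((Polynomial.C 4 * X) ^ (4 * (k + 5 - j)) * (Polynomial.C (-4) * (1 - X ^ 4) ^ 2) ^ j) := by
    refine eq_of_eval_eq_Ioo fun y h0 h1 => ?_
    have h := eval_shadow hI.1 h0
    rw [hA, hf, eval_finsetSum, Finset.mul_sum] at h
    rw [eval_finsetSum, eval_finsetSum]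
    simp only [eval_mul, eval_C, eval_pow, eval_X, eval_sub, eval_one]
    rw [h]
    refine Finset.sum_congr rfl fun j hj => ?_
    rw [eval_mul, eval_C, ← gleason_shadow (Finset.mem_range.1 hj).le h0]
    ring
  have h4 := congrArg (fun P => P.coeff 4) hpoly
  simp only [finsetSum_coeff, coeff_C_mul, coeff_X_pow, mul_ite, mul_one, mul_zero] at h4
  rw [Finset.sum_range_succ, Finset.sum_eq_zero (s := Finset.range (k + 4))] at h4
  · rw [show k + 5 - (k + 4) = 1 by omega, mul_one, mul_pow, ← map_pow, mul_assoc, coeff_C_mul,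
      show (4 : ℕ) = 0 + 4 by norm_num, coeff_X_pow_mul, coeff_zero_eq_eval_zero] at h4
    simp only [sum_shadowChar hI.1] at h4
    rw [← Finset.sum_filter, ← Finset.sum_filter, Finset.filter_filter, Finset.sum_const,
      nsmul_eq_mul, hC.card_eq] at h4
    have hN := card_shadow_le_one (by omega) hI.1 hC
    have hcard : ((Finset.univ.filter fun u : Fin (8 * (k + 5)) → ZMod 2 =>
      4 = hammingNorm u ∧ ∀ c ∈ C, shadowChar u c = 1).card : ℝ) ≤ 1 := by exact_mod_cast hN
    simp only [eval_pow, eval_mul, eval_C, eval_sub, eval_one, eval_X, zero_pow four_ne_zero,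
      sub_zero, one_pow, mul_one, zero_add] at h4
    have habs := congrArg abs h4
    rw [abs_of_nonneg (by positivity), abs_mul, abs_mul, abs_pow, abs_pow, abs_neg,
      Nat.abs_ofNat] at habs
    have e : ((2 ^ (4 * (k + 5)) : ℕ) : ℝ) = 4 ^ (k + 2) * (4 ^ 4 * 4 ^ (k + 4)) := by
      push_cast
      rw [pow_mul, ← pow_add, ← pow_add, show (2 : ℝ) ^ 4 = 4 ^ 2 by norm_num, ← pow_mul]
      congr 1
      omega
    rw [e] at habs
    have hpos : (0 : ℝ) < 4 ^ 4 * 4 ^ (k + 4) := by positivity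
    have h1 : |a (k + 4)| ≤ 4 ^ (k + 2) := by
      refine le_of_mul_le_mul_right ?_ hpos
      rw [← habs, ← mul_assoc]
      refine mul_le_mul_of_nonneg_right ?_ hpos.le
      exact mul_le_of_le_one_left (by positivity) hcard
    linarith [neg_abs_le (a (k + 4))]
  · intro j hj
    have := Finset.mem_range.1 hj
    rw [mul_pow, ← map_pow, mul_assoc, coeff_C_mul, coeff_X_pow_mul', if_neg (by omega)]
    ring

/-! ### The Type I code of length 16 -/

theorem card_words_eq_pow_finrank {n : ℕ} (C : Code n) :
    (words C).card = 2 ^ Module.finrank (ZMod 2) C := by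
  have h := Module.card_eq_pow_finrank (K := ZMod 2) (V := C)
  rw [ZMod.card] at h
  rw [← h, words, Fintype.card_subtype]

/-- The coordinates of the code, arranged in two blocks of four pairs. -/
abbrev Idx := Fin 2 × Fin 4 × ZMod 2

/-- Generators of the code. For `i ≠ 0` the generator `(k, i)` is the union of the pairs `0` and `i`
of the block `k`; the generator `(k, 0)` is a transversal of the pairs of the block `k` together
with the pair `0` of the other block. -/
def gen (g : Fin 2 × Fin 4) (p : Idx) : ZMod 2 :=
  if g.2 = 0 then (if p.1 = g.1 then p.2.2 else if p.2.1 = 0 then 1 else 0)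
  else if p.1 = g.1 ∧ (p.2.1 = 0 ∨ p.2.1 = g.2) then 1 else 0

theorem gen_orthogonal : ∀ g h : Fin 2 × Fin 4, ∑ p, gen g p * gen h p = 0 := by
  decide +kernel

/-- One enumeration of the 2^8 combinations serves both linear independence and the minimum
distance. -/
theorem four_le_weight_gen : ∀ a : Fin 2 × Fin 4 → ZMod 2, a ≠ 0 →
    4 ≤ (Finset.univ.filter fun p : Idx => ∑ g, a g * gen g p ≠ 0).card := by
  decide +kernel

theorem weight_gen : (Finset.univ.filter fun p : Idx => gen (0, 0) p ≠ 0).card = 6 ∧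
    (Finset.univ.filter fun p : Idx => gen (0, 1) p ≠ 0).card = 4 := by
  decide +kernel

/-- A numbering of the coordinates. -/
noncomputable def idxEquiv : Fin 16 ≃ Idx := (Fintype.equivFinOfCardEq (by decide)).symm

/-- The Type I code with parameters `[16, 8, 4]`. -/
noncomputable def typeISixteen : Code 16 :=
  Submodule.span (ZMod 2) (Set.range fun g : Fin 2 × Fin 4 => gen g ∘ idxEquiv)

theorem hammingNorm_comp_equiv {n : ℕ} {ι : Type*} [Fintype ι] (e : Fin n ≃ ι) (x : ι → ZMod 2) :
    hammingNorm (x ∘ e) = (Finset.univ.filter fun p => x p ≠ 0).card := by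
  rw [hammingNorm]
  exact Finset.card_bij (fun i _ => e i) (by simp) (by simp) fun p hp =>
    ⟨e.symm p, by simpa using hp, by simp⟩

theorem four_le_weight_comb {a : Fin 2 × Fin 4 → ZMod 2} (ha : a ≠ 0) :
    4 ≤ hammingNorm (∑ g, a g • (gen g ∘ idxEquiv)) := by
  have e : ∑ g, a g • (gen g ∘ idxEquiv) = (fun p => ∑ g, a g * gen g p) ∘ idxEquiv := by
    ext i
    simp
  rw [e, hammingNorm_comp_equiv]
  exact four_le_weight_gen a ha

theorem finrank_typeISixteen : Module.finrank (ZMod 2) typeISixteen = 8 := by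
  have hli : LinearIndependent (ZMod 2) fun g : Fin 2 × Fin 4 => gen g ∘ idxEquiv := by
    rw [Fintype.linearIndependent_iff]
    intro a ha
    by_contra hne
    have h0 : a ≠ 0 := fun h => hne fun g => by rw [h]; rfl
    have := four_le_weight_comb h0
    rw [ha, hammingNorm_zero] at this
    omega
  rw [typeISixteen, finrank_span_eq_card hli]
  simp

theorem dual_typeISixteen : dual typeISixteen = typeISixteen := by
  have hle : typeISixteen ≤ dual typeISixteen := by
    refine Submodule.span_le.2 ?_
    rintro _ ⟨h, rfl⟩
    change ∀ x ∈ typeISixteen, ∑ i, x i * gen h (idxEquiv i) = 0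
    intro x hx
    induction hx using Submodule.span_induction with
    | mem x hx =>
      obtain ⟨g, rfl⟩ := hx
      exact (Equiv.sum_comp idxEquiv fun p => gen g p * gen h p).trans (gen_orthogonal g h)
    | zero => simp
    | add x y _ _ hx hy => simp [add_mul, Finset.sum_add_distrib, hx, hy]
    | smul a x _ hx => simp [mul_assoc, ← Finset.mul_sum, hx]
  refine (eq_of_le_of_card_le hle ?_).symm
  have h := card_words_mul_card_words_dual typeISixteen
  rw [card_words_eq_pow_finrank typeISixteen, finrank_typeISixteen] at h ⊢
  omega

theorem gen_mem (g : Fin 2 × Fin 4) : gen g ∘ idxEquiv ∈ typeISixteen :=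
  Submodule.subset_span ⟨g, rfl⟩

theorem isTypeI_typeISixteen : IsTypeI typeISixteen := by
  refine ⟨dual_typeISixteen, fun h => ?_⟩
  have := h _ (gen_mem (0, 0))
  rw [hammingNorm_comp_equiv, weight_gen.1] at this
  omega

theorem hasParams_typeISixteen : HasParams typeISixteen 8 4 := by
  refine ⟨finrank_typeISixteen, ⟨gen (0, 1) ∘ idxEquiv, gen_mem _, ?_, ?_⟩, ?_⟩
  · intro h
    have := hammingNorm_comp_equiv idxEquiv (gen (0, 1))
    rw [h, hammingNorm_zero, weight_gen.2] at this
    omega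
  · rw [hammingNorm_comp_equiv, weight_gen.2]
  · rintro w ⟨x, hx, hx0, rfl⟩
    obtain ⟨a, rfl⟩ := (Submodule.mem_span_range_iff_exists_fun (ZMod 2)).1 hx
    refine four_le_weight_comb fun ha => hx0 ?_
    simp [ha]

/-! ### Uniqueness -/

/-- The twelve words of weight four form a 1-design on 16 points, and 12 · 4 / 16 = 3. -/
theorem card_four_through {D : Code (8 * 2)} (hI : IsTypeI D) (hD : IsBalanced D)
    (p : Fin (8 * 2)) : ((wordsOfWeight D 4).filter fun x => x p = 1).card = 3 := by
  have h4 := card_two_four hI hD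
  have hw : 4 ∈ properWeights D := by
    obtain ⟨x, hx⟩ := Finset.card_pos.1 (by omega : 0 < (wordsOfWeight D 4).card)
    obtain ⟨hx, hxw⟩ := mem_wordsOfWeight.1 hx
    exact ⟨by norm_num, by norm_num, x, hx, hxw⟩
  obtain ⟨l, hl⟩ := isSupportDesign_one (by norm_num) hI.1 hD hw
  have h1 := hl.card_one_mul
  rw [card_blocks, h4] at h1
  have h2 := cov_blocks_singleton D 4 p
  rw [hl.cov_eq (Finset.card_singleton p)] at h2
  have h3 : ∀ x : Fin (8 * 2) → ZMod 2, bit (x p) = if x p = 1 then 1 else 0 := by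
    intro x
    rcases zmod_two_cases (x p) with h | h <;> simp [h]
  simp only [h3, Finset.sum_boole] at h2
  have : l = ((wordsOfWeight D 4).filter fun x => x p = 1).card := by exact_mod_cast h2
  omega

/-- Four disjoint pairs of coordinates such that the unions of two of them are exactly the
codewords of weight four that meet one of them. -/
structure IsComponent {n : ℕ} (D : Code n) (δ : Fin 4 → Fin n → ZMod 2) : Prop where
  add_mem : ∀ i j, δ i + δ j ∈ D
  weight : ∀ i, hammingNorm (δ i) = 2
  disj : ∀ i j s, i ≠ j → δ i s = 1 → δ j s = 0
  cover : ∀ W ∈ D, hammingNorm W = 4 → ∀ i s, δ i s = 1 → W s = 1 → ∃ j, j ≠ i ∧ W = δ i + δ j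

theorem hammingNorm_mul_le {n : ℕ} (x y : Fin n → ZMod 2) :
    hammingNorm (x * y) ≤ hammingNorm x := by
  refine Finset.card_le_card fun i hi => ?_
  simp only [Finset.mem_filter, Finset.mem_univ, true_and, Pi.mul_apply] at hi ⊢
  exact left_ne_zero_of_mul hi

theorem mul_eq_of_hammingNorm_eq {n : ℕ} {x y : Fin n → ZMod 2}
    (h : hammingNorm (x * y) = hammingNorm x) : x * y = x := by
  have hs : (Finset.univ.filter fun i => (x * y) i ≠ 0) = Finset.univ.filter fun i => x i ≠ 0 := by
    refine Finset.eq_of_subset_of_card_le (fun i hi => ?_) h.ge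
    simp only [Finset.mem_filter, Finset.mem_univ, true_and, Pi.mul_apply] at hi ⊢
    exact left_ne_zero_of_mul hi
  ext i
  have hi := Finset.ext_iff.1 hs i
  simp only [Finset.mem_filter, Finset.mem_univ, true_and, Pi.mul_apply] at hi ⊢
  revert hi
  generalize x i = a
  generalize y i = b
  revert a b
  decide

theorem mul_self_zmod_two {n : ℕ} (x : Fin n → ZMod 2) : x * x = x := by
  ext i
  simp only [Pi.mul_apply]
  generalize x i = a
  revert a; decide

theorem add_self_zmod_two {n : ℕ} (x : Fin n → ZMod 2) : x + x = 0 :=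
  funext fun i => CharTwo.add_self_eq_zero (x i)

theorem eq_of_add_eq_zero {n : ℕ} {x y : Fin n → ZMod 2} (h : x + y = 0) : x = y :=
  funext fun i => CharTwo.add_eq_zero.1 (congrFun h i)

/-- Two words of weight four through a common point meet in two points. -/
theorem hammingNorm_mul_eq_two {n : ℕ} {D : Code n} (hs : dual D = D)
    (hmin : ∀ x ∈ D, x ≠ 0 → 4 ≤ hammingNorm x)
    {x y : Fin n → ZMod 2} (hx : x ∈ D) (hy : y ∈ D) (hx4 : hammingNorm x = 4)
    (hy4 : hammingNorm y = 4) (hxy : x ≠ y) {p : Fin n} (hxp : x p = 1) (hyp : y p = 1) :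
    hammingNorm (x * y) = 2 := by
  have h1 := hammingNorm_add x y
  have h2 := hmin (x + y) (D.add_mem hx hy) fun h => hxy (eq_of_add_eq_zero h)
  have h3 : 0 < hammingNorm (x * y) := by
    rw [hammingNorm_pos_iff]
    intro h
    have := congrFun h p
    simp [hxp, hyp] at this
  have h4 := even_hammingNorm_mul hs hx hy
  omega

theorem sunflower_disjoint (a b c d : ZMod 2) (i j : Fin 4) (h1 : d = a * b) (h2 : d = a * c)
    (h3 : d = b * c) (hij : i ≠ j) :
    d + (![0, a, b, c] : Fin 4 → ZMod 2) i = 1 → d + (![0, a, b, c] : Fin 4 → ZMod 2) j = 0 := by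
  have h11 : (1 : ZMod 2) + 1 = 0 := by decide
  subst h1
  rcases zmod_two_cases a with rfl | rfl <;> rcases zmod_two_cases b with rfl | rfl <;>
    rcases zmod_two_cases c with rfl | rfl <;> fin_cases i <;> fin_cases j <;>
    simp_all

/-- The three words of weight four through p share a pair e, and the four pairs are e and the three
petals. -/
theorem exists_isComponent {n : ℕ} {D : Code n} (hs : dual D = D)
    (hmin : ∀ x ∈ D, x ≠ 0 → 4 ≤ hammingNorm x)
    (h3 : ∀ p : Fin n, ((wordsOfWeight D 4).filter fun x => x p = 1).card = 3)
    (p : Fin n) : ∃ δ, IsComponent D δ ∧ δ 0 p = 1 := by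
  obtain ⟨x, y, z, hxy, hxz, hyz, hT⟩ := Finset.card_eq_three.1 (h3 p)
  have hmem : ∀ w, (w ∈ D ∧ hammingNorm w = 4) ∧ w p = 1 ↔ w = x ∨ w = y ∨ w = z := by
    intro w
    have := Finset.ext_iff.1 hT w
    simpa [mem_wordsOfWeight] using this
  obtain ⟨⟨hx, hx4⟩, hxp⟩ := (hmem x).2 (Or.inl rfl)
  obtain ⟨⟨hy, hy4⟩, hyp⟩ := (hmem y).2 (Or.inr (Or.inl rfl))
  obtain ⟨⟨hz, hz4⟩, hzp⟩ := (hmem z).2 (Or.inr (Or.inr rfl))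
  have nxy := hammingNorm_mul_eq_two hs hmin hx hy hx4 hy4 hxy hxp hyp
  have nxz := hammingNorm_mul_eq_two hs hmin hx hz hx4 hz4 hxz hxp hzp
  have nyz := hammingNorm_mul_eq_two hs hmin hy hz hy4 hz4 hyz hyp hzp
  -- If the triple intersection were the single point p, x + y + z would be a fourth word of weight
  -- four through p.
  have nxyz : hammingNorm (x * y * z) = 2 := by
    have hle := hammingNorm_mul_le (x * y) z
    have hpos : 0 < hammingNorm (x * y * z) := by
      rw [hammingNorm_pos_iff]
      intro h
      have := congrFun h p
      simp [hxp, hyp, hzp] at this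
    have h1 := hammingNorm_add x y
    have h2 := hammingNorm_add (x * z) (y * z)
    rw [show x * z * (y * z) = x * y * (z * z) by ring, mul_self_zmod_two] at h2
    have h3 := hammingNorm_add (x + y) z
    rw [add_mul] at h3
    by_contra hne
    have h4 : hammingNorm (x + y + z) = 4 := by omega
    have h5 := (hmem (x + y + z)).1 ⟨⟨D.add_mem (D.add_mem hx hy) hz, h4⟩, by
      simp only [Pi.add_apply, hxp, hyp, hzp]; decide⟩
    rcases h5 with h | h | h
    · exact hyz (eq_of_add_eq_zero (by rw [add_assoc] at h; exact left_eq_add.1 h.symm))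
    · exact hxz (eq_of_add_eq_zero (by
        rw [add_comm x y, add_assoc] at h; exact left_eq_add.1 h.symm))
    · exact hxy (eq_of_add_eq_zero (by exact right_eq_add.1 h.symm))
  have e1 : x * y * z = x * y := mul_eq_of_hammingNorm_eq (nxyz.trans nxy.symm)
  have e2 : x * y * z = x * z := by
    rw [mul_right_comm]
    exact mul_eq_of_hammingNorm_eq (by rw [mul_right_comm, nxyz, nxz])
  have e3 : x * y * z = y * z := by
    rw [show x * y * z = y * z * x by ring]
    exact mul_eq_of_hammingNorm_eq (by rw [show y * z * x = x * y * z by ring, nxyz, nyz])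
  set e := x * y * z with he
  set g : Fin 4 → Fin n → ZMod 2 := ![0, x, y, z] with hg
  have hgm : ∀ i, g i ∈ D := by
    intro i
    fin_cases i
    exacts [D.zero_mem, hx, hy, hz]
  have he1 : ∀ w, w = x ∨ w = y ∨ w = z → hammingNorm w = 4 → e * w = e →
      hammingNorm (e + w) = 2 := by
    intro w _ hw4 hew
    have := hammingNorm_add e w
    rw [hew] at this
    omega
  have hwt : ∀ i, hammingNorm (e + g i) = 2 := by
    intro i
    have hex : e * x = e := by
      rw [he, show x * y * z * x = x * x * y * z by ring, mul_self_zmod_two]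
    have hey : e * y = e := by
      rw [he, show x * y * z * y = x * (y * y) * z by ring, mul_self_zmod_two]
    have hez : e * z = e := by
      rw [he, show x * y * z * z = x * y * (z * z) by ring, mul_self_zmod_two]
    fin_cases i
    · simpa [hg] using nxyz
    · exact he1 x (Or.inl rfl) hx4 hex
    · exact he1 y (Or.inr (Or.inl rfl)) hy4 hey
    · exact he1 z (Or.inr (Or.inr rfl)) hz4 hez
  have hdisj : ∀ i j s, i ≠ j → (e + g i) s = 1 → (e + g j) s = 0 := by
    intro i j s hij
    have f1 := congrFun e1 s
    have f2 := congrFun e2 s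
    have f3 := congrFun e3 s
    simp only [Pi.mul_apply] at f1 f2 f3
    simp only [Pi.add_apply]
    have hgi : ∀ i, g i s = (![0, x s, y s, z s] : Fin 4 → ZMod 2) i := by
      intro i
      fin_cases i <;> rfl
    rw [hgi, hgi]
    exact sunflower_disjoint _ _ _ _ _ _ f1 f2 f3 hij
  have hadd : ∀ i j, e + g i + (e + g j) = g i + g j := by
    intro i j
    rw [show e + g i + (e + g j) = (e + e) + (g i + g j) by ring, add_self_zmod_two, zero_add]
  have hwt4 : ∀ i j, i ≠ j → hammingNorm (e + g i + (e + g j)) = 4 := by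
    intro i j hij
    have h := hammingNorm_add (e + g i) (e + g j)
    have h0 : (e + g i) * (e + g j) = 0 := by
      ext s
      rcases zmod_two_cases ((e + g i) s) with h | h
      · rw [Pi.mul_apply, h, zero_mul]; rfl
      · rw [Pi.mul_apply, hdisj i j s hij h, mul_zero]; rfl
    rw [h0, hammingNorm_zero, hwt, hwt] at h
    omega
  refine ⟨fun i => e + g i, ⟨?_, hwt, hdisj, ?_⟩, ?_⟩
  · intro i j
    rw [hadd]
    exact D.add_mem (hgm i) (hgm j)
  · intro W hW hW4 i s his hWs
    have hinj : Set.InjOn (fun j => e + g i + (e + g j))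
        ((Finset.univ.erase i : Finset (Fin 4)) : Set (Fin 4)) := by
      intro j _ k _ hjk
      by_contra hne
      have h1 : e + g j = e + g k := add_left_cancel hjk
      have h2 := hwt j
      have h3 : e + g j = 0 := by
        ext r
        rcases zmod_two_cases ((e + g j) r) with h | h
        · exact h
        · rw [h1]; exact hdisj j k r hne h
      rw [h3, hammingNorm_zero] at h2
      omega
    -- The three sums of pair i with another pair exhaust the three words of weight four through s.
    have himg : (Finset.univ.erase i).image (fun j => e + g i + (e + g j)) =
        (wordsOfWeight D 4).filter fun x => x s = 1 := by
      refine Finset.eq_of_subset_of_card_le ?_ ?_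
      · intro w hw
        obtain ⟨j, hj, rfl⟩ := Finset.mem_image.1 hw
        have hji : j ≠ i := Finset.ne_of_mem_erase hj
        refine Finset.mem_filter.2 ⟨mem_wordsOfWeight.2 ⟨?_, hwt4 i j hji.symm⟩, ?_⟩
        · rw [hadd]
          exact D.add_mem (hgm i) (hgm j)
        · rw [Pi.add_apply, his, hdisj i j s hji.symm his, add_zero]
      · rw [h3 s, Finset.card_image_of_injOn hinj]
        simp
    have hWm : W ∈ (wordsOfWeight D 4).filter fun x => x s = 1 :=
      Finset.mem_filter.2 ⟨mem_wordsOfWeight.2 ⟨hW, hW4⟩, hWs⟩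
    rw [← himg] at hWm
    obtain ⟨j, hj, rfl⟩ := Finset.mem_image.1 hWm
    exact ⟨j, Finset.ne_of_mem_erase hj, rfl⟩
  · simp [hg, he, hxp, hyp, hzp]

theorem IsComponent.weight_add {n : ℕ} {D : Code n} {δ : Fin 4 → Fin n → ZMod 2}
    (h : IsComponent D δ) {i j : Fin 4} (hij : i ≠ j) : hammingNorm (δ i + δ j) = 4 := by
  have h1 := hammingNorm_add (δ i) (δ j)
  have h0 : δ i * δ j = 0 := by
    ext s
    rcases zmod_two_cases (δ i s) with h' | h'
    · rw [Pi.mul_apply, h', zero_mul]; rfl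
    · rw [Pi.mul_apply, h.disj i j s hij h', mul_zero]; rfl
  rw [h0, hammingNorm_zero, h.weight, h.weight] at h1
  omega

theorem exists_two_components {n : ℕ} (hn : n = 16) {D : Code n} (hs : dual D = D)
    (hmin : ∀ x ∈ D, x ≠ 0 → 4 ≤ hammingNorm x)
    (h3 : ∀ p : Fin n, ((wordsOfWeight D 4).filter fun x => x p = 1).card = 3) :
    ∃ δ : Fin 2 → Fin 4 → Fin n → ZMod 2, (∀ k, IsComponent D (δ k)) ∧
      ∀ k i l j s, (k, i) ≠ (l, j) → δ k i s = 1 → δ l j s = 0 := by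
  obtain ⟨δ, hδ, -⟩ := exists_isComponent hs hmin h3 ⟨0, by omega⟩
  -- Four pairs cover at most eight of the sixteen coordinates.
  obtain ⟨p, hp⟩ : ∃ p, ∀ i, δ i p = 0 := by
    by_contra hcon
    push Not at hcon
    have hsub : (Finset.univ : Finset (Fin n)) ⊆
        Finset.univ.biUnion fun i => Finset.univ.filter fun s => δ i s ≠ 0 := by
      intro s _
      obtain ⟨i, hi⟩ := hcon s
      simpa using ⟨i, hi⟩
    have h1 := (Finset.card_le_card hsub).trans Finset.card_biUnion_le
    have h2 : ∀ i, (Finset.univ.filter fun s => δ i s ≠ 0).card = 2 := hδ.weight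
    simp only [h2] at h1
    simp at h1
    omega
  obtain ⟨ε, hε, hεp⟩ := exists_isComponent hs hmin h3 p
  have hcross : ∀ i j s, ε i s = 1 → δ j s = 0 := by
    intro i j s his
    by_contra hjs
    replace hjs := (zmod_two_cases _).resolve_left hjs
    -- This word contains both s and p; `hδ.cover` would place it inside the first component, which
    -- avoids p.
    obtain ⟨i', hi', hW⟩ : ∃ i', (0 : Fin 4) ≠ i' ∧ (ε 0 + ε i') s = 1 := by
      by_cases hi : i = 0
      · subst hi
        exact ⟨1, by decide, by rw [Pi.add_apply, his, hε.disj 0 1 s (by decide) his, add_zero]⟩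
      · exact ⟨i, Ne.symm hi, by rw [Pi.add_apply, his, hε.disj i 0 s hi his, zero_add]⟩
    obtain ⟨j', -, he⟩ := hδ.cover _ (hε.add_mem 0 i') (hε.weight_add hi') j s hjs hW
    have := congrFun he p
    rw [Pi.add_apply, Pi.add_apply, hεp, hε.disj 0 i' p hi' hεp, hp, hp] at this
    exact absurd this (by decide)
  have hcross' : ∀ i j s, δ j s = 1 → ε i s = 0 := by
    intro i j s hjs
    by_contra his
    rw [hcross i j s ((zmod_two_cases _).resolve_left his)] at hjs
    exact absurd hjs (by decide)
  refine ⟨![δ, ε], ?_, ?_⟩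
  · intro k
    fin_cases k
    exacts [hδ, hε]
  · intro k i l j s hne
    fin_cases k <;> fin_cases l
    · exact hδ.disj i j s fun h => hne (by rw [h])
    · exact hcross' j i s
    · exact hcross i j s
    · exact hε.disj i j s fun h => hne (by rw [h])

theorem exists_points_of_weight_two {n : ℕ} {d : Fin n → ZMod 2} (h : hammingNorm d = 2) :
    ∃ s t, s ≠ t ∧ d s = 1 ∧ d t = 1 ∧ (∀ r, d r = 1 → r = s ∨ r = t) ∧
      ∀ c : Fin n → ZMod 2, ∑ r, c r * d r = c s + c t := by
  obtain ⟨s, t, hst, he⟩ := Finset.card_eq_two.1 h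
  have hm : ∀ r, d r ≠ 0 ↔ r = s ∨ r = t := by
    intro r
    simpa using Finset.ext_iff.1 he r
  have hd : ∀ r, d r = if r ∈ ({s, t} : Finset (Fin n)) then 1 else 0 := by
    intro r
    simp only [Finset.mem_insert, Finset.mem_singleton]
    split_ifs with hr
    · exact (zmod_two_cases _).resolve_left ((hm r).2 hr)
    · by_contra hne
      exact hr ((hm r).1 hne)
  refine ⟨s, t, hst, ?_, ?_, ?_, ?_⟩
  · simp [hd]
  · simp [hd]
  · intro r hr
    exact (hm r).1 (by rw [hr]; decide)
  · intro c
    simp only [hd, mul_ite, mul_one, mul_zero]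
    rw [Finset.sum_ite_mem, Finset.univ_inter, Finset.sum_pair hst]

section Labelling

variable {n : ℕ} {D : Code n} {δ : Fin 2 → Fin 4 → Fin n → ZMod 2}

theorem component_cover (hn : n = 16) (hδ : ∀ k, IsComponent D (δ k))
    (hdis : ∀ k i l j s, (k, i) ≠ (l, j) → δ k i s = 1 → δ l j s = 0) (s : Fin n) :
    ∃ k i, δ k i s = 1 := by
  have hU : (Finset.univ.biUnion fun g : Fin 2 × Fin 4 =>
      Finset.univ.filter fun s => δ g.1 g.2 s ≠ 0) = Finset.univ := by
    rw [← Finset.card_eq_iff_eq_univ, Finset.card_biUnion]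
    · have h2 : ∀ g : Fin 2 × Fin 4, (Finset.univ.filter fun s => δ g.1 g.2 s ≠ 0).card = 2 :=
        fun g => (hδ g.1).weight g.2
      simp only [h2]
      simp [hn]
    · intro g _ h _ hgh
      rw [Function.onFun, Finset.disjoint_left]
      intro s hs hs'
      simp only [Finset.mem_filter, Finset.mem_univ, true_and] at hs hs'
      exact hs' (hdis g.1 g.2 h.1 h.2 s hgh ((zmod_two_cases _).resolve_left hs))
  have := Finset.mem_univ s
  rw [← hU] at this
  simp only [Finset.mem_biUnion, Finset.mem_univ, true_and, Finset.mem_filter] at this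
  obtain ⟨g, hg⟩ := this
  exact ⟨g.1, g.2, (zmod_two_cases _).resolve_left hg⟩

/-- Orthogonality to the sum of two pairs gives a codeword the same parity on all pairs of a
component. -/
theorem inner_component_eq (hs : dual D = D) (hδ : ∀ k, IsComponent D (δ k)) {c : Fin n → ZMod 2}
    (hc : c ∈ D) (k : Fin 2) (i : Fin 4) : ∑ r, c r * δ k i r = ∑ r, c r * δ k 0 r := by
  have h : δ k i + δ k 0 ∈ dual D := by rw [hs]; exact (hδ k).add_mem i 0
  have := h c hc
  simp only [Pi.add_apply, mul_add, Finset.sum_add_distrib] at this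
  exact CharTwo.add_eq_zero.1 this

/-- There is a codeword meeting the pairs of one component oddly and those of the other evenly. -/
theorem exists_odd_even (hs : dual D = D) (hmin : ∀ x ∈ D, x ≠ 0 → 4 ≤ hammingNorm x)
    (hδ : ∀ k, IsComponent D (δ k))
    (hdis : ∀ k i l j s, (k, i) ≠ (l, j) → δ k i s = 1 → δ l j s = 0) {k l : Fin 2} (hkl : k ≠ l) :
    ∃ c ∈ D, ∑ r, c r * δ k 0 r = 1 ∧ ∑ r, c r * δ l 0 r = 0 := by
  -- Otherwise the weight-two vector δ k 0 would lie in the dual, which is D.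
  have h1 : ∃ c ∈ D, ∑ r, c r * δ k 0 r = 1 := by
    by_contra hcon
    push Not at hcon
    have hmem : δ k 0 ∈ D := by
      rw [← hs]
      intro c hc
      by_contra h
      exact hcon c hc ((zmod_two_cases _).resolve_left h)
    have h2 := (hδ k).weight 0
    have := hmin _ hmem fun h => by rw [h, hammingNorm_zero] at h2; omega
    omega
  -- Otherwise δ k 0 + δ l 0 would be a word of weight four meeting both components, against
  -- `cover`.
  have h2 : ∃ c ∈ D, ∑ r, c r * δ k 0 r + ∑ r, c r * δ l 0 r = 1 := by
    by_contra hcon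
    push Not at hcon
    have hmem : δ k 0 + δ l 0 ∈ D := by
      rw [← hs]
      intro c hc
      simp only [Pi.add_apply, mul_add, Finset.sum_add_distrib]
      by_contra h
      exact hcon c hc ((zmod_two_cases _).resolve_left h)
    have hmul : δ k 0 * δ l 0 = 0 := by
      ext s
      rcases zmod_two_cases (δ k 0 s) with h' | h'
      · rw [Pi.mul_apply, h', zero_mul]; rfl
      · rw [Pi.mul_apply, hdis k 0 l 0 s (fun h => hkl (Prod.ext_iff.1 h).1) h', mul_zero]; rfl
    have hw : hammingNorm (δ k 0 + δ l 0) = 4 := by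
      have := hammingNorm_add (δ k 0) (δ l 0)
      rw [hmul, hammingNorm_zero, (hδ k).weight, (hδ l).weight] at this
      omega
    obtain ⟨s, t, -, hs1, -, -, -⟩ := exists_points_of_weight_two ((hδ k).weight 0)
    obtain ⟨s', t', -, hs2, -, -, -⟩ := exists_points_of_weight_two ((hδ l).weight 0)
    have hlk : ∀ j, (l, (0 : Fin 4)) ≠ (k, j) := fun j h => hkl (Prod.ext_iff.1 h).1.symm
    have hkl' : (k, (0 : Fin 4)) ≠ (l, 0) := fun h => hkl (Prod.ext_iff.1 h).1
    obtain ⟨j, -, he⟩ := (hδ k).cover _ hmem hw 0 s hs1 (by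
      rw [Pi.add_apply, hs1, hdis k 0 l 0 s hkl' hs1, add_zero])
    have := congrFun he s'
    rw [Pi.add_apply, Pi.add_apply, hs2, hdis l 0 k 0 s' (hlk 0) hs2,
      hdis l 0 k j s' (hlk j) hs2] at this
    exact absurd this (by decide)
  obtain ⟨c, hc, hck⟩ := h1
  obtain ⟨c', hc', hck'⟩ := h2
  rcases zmod_two_cases (∑ r, c r * δ l 0 r) with h | h
  · exact ⟨c, hc, hck, h⟩
  rcases zmod_two_cases (∑ r, c' r * δ l 0 r) with h' | h'
  · rw [h', add_zero] at hck'
    exact ⟨c', hc', hck', h'⟩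
  · refine ⟨c + c', D.add_mem hc hc', ?_, ?_⟩
    · simp only [Pi.add_apply, add_mul, Finset.sum_add_distrib, hck]
      rw [h'] at hck'
      rw [add_eq_right.1 hck', add_zero]
    · simp only [Pi.add_apply, add_mul, Finset.sum_add_distrib, h, h']
      decide

/-- The glue words. -/
theorem exists_glue (hn : n = 16) (hs : dual D = D) (hmin : ∀ x ∈ D, x ≠ 0 → 4 ≤ hammingNorm x)
    (hδ : ∀ k, IsComponent D (δ k))
    (hdis : ∀ k i l j s, (k, i) ≠ (l, j) → δ k i s = 1 → δ l j s = 0) {k l : Fin 2} (hkl : k ≠ l) :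
    ∃ v ∈ D, (∀ i, ∑ r, v r * δ k i r = 1) ∧ (∀ r, δ l 0 r = 1 → v r = 1) ∧
      ∀ j ≠ 0, ∀ r, δ l j r = 1 → v r = 0 := by
  obtain ⟨c, hc, hck, hcl⟩ := exists_odd_even hs hmin hδ hdis hkl
  choose S T hST hS1 hT1 hall hsum using fun k i =>
    exists_points_of_weight_two ((hδ k).weight i)
  have hST' : ∀ i, c (S l i) = c (T l i) := by
    intro i
    have := inner_component_eq hs hδ hc l i
    rw [hcl, hsum] at this
    exact CharTwo.add_eq_zero.1 this
  -- On each pair of component l the word c is constant; these summands clear its pairs 1, 2, 3 and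
  -- leave component k untouched.
  set v := c + (c (S l 1) • (δ l 0 + δ l 1) + c (S l 2) • (δ l 0 + δ l 2) +
    c (S l 3) • (δ l 0 + δ l 3)) with hv
  have hvD : v ∈ D := D.add_mem hc (D.add_mem (D.add_mem (D.smul_mem _ ((hδ l).add_mem _ _))
    (D.smul_mem _ ((hδ l).add_mem _ _))) (D.smul_mem _ ((hδ l).add_mem _ _)))
  have hvr : ∀ r, v r = c r + (c (S l 1) * (δ l 0 r + δ l 1 r) + c (S l 2) * (δ l 0 r + δ l 2 r) +
      c (S l 3) * (δ l 0 r + δ l 3 r)) := fun r => rfl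
  have hvk : ∀ i r, δ k i r = 1 → v r = c r := by
    intro i r hr
    have h0 : ∀ j, δ l j r = 0 := fun j =>
      hdis k i l j r (fun h => hkl (Prod.ext_iff.1 h).1) hr
    rw [hvr, h0, h0, h0, h0]
    ring
  have hodd : ∀ i, ∑ r, v r * δ k i r = 1 := by
    intro i
    rw [hsum, hvk i _ (hS1 k i), hvk i _ (hT1 k i), ← hsum k i c, inner_component_eq hs hδ hc, hck]
  have hzero : ∀ j ≠ 0, ∀ r, δ l j r = 1 → v r = 0 := by
    intro j hj r hr
    have hcr : c r = c (S l j) := by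
      rcases hall l j r hr with h | h
      · rw [h]
      · rw [h, hST']
    have h0 : ∀ j', j' ≠ j → δ l j' r = 0 := fun j' hj' => (hδ l).disj j j' r hj'.symm hr
    rw [hvr, hcr]
    fin_cases j
    · exact absurd rfl hj
    · have hr' : δ l 1 r = 1 := hr
      rw [hr', h0 0 (by decide), h0 2 (by decide), h0 3 (by decide)]
      simp only [zero_add, mul_one, mul_zero, add_zero]
      exact CharTwo.add_self_eq_zero _
    · have hr' : δ l 2 r = 1 := hr
      rw [hr', h0 0 (by decide), h0 1 (by decide), h0 3 (by decide)]
      simp only [zero_add, mul_one, mul_zero, add_zero]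
      exact CharTwo.add_self_eq_zero _
    · have hr' : δ l 3 r = 1 := hr
      rw [hr', h0 0 (by decide), h0 1 (by decide), h0 2 (by decide)]
      simp only [zero_add, mul_one, mul_zero, add_zero]
      exact CharTwo.add_self_eq_zero _
  have hconst : ∀ r, δ l 0 r = 1 → v r = v (S l 0) := by
    intro r hr
    rcases hall l 0 r hr with h | h
    · rw [h]
    · have h0 : ∀ q, δ l 0 q = 1 → ∀ j, j ≠ 0 → δ l j q = 0 := fun q hq j hj =>
        (hδ l).disj 0 j q hj.symm hq
      rw [h, hvr, hvr, hST' 0, hT1, hS1]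
      simp only [h0 _ (hT1 l 0) 1 (by decide), h0 _ (hT1 l 0) 2 (by decide),
        h0 _ (hT1 l 0) 3 (by decide), h0 _ (hS1 l 0) 1 (by decide), h0 _ (hS1 l 0) 2 (by decide),
        h0 _ (hS1 l 0) 3 (by decide)]
  refine ⟨v, hvD, hodd, fun r hr => ?_, hzero⟩
  rw [hconst r hr]
  -- If v vanished on pair 0 of l too, it would have one point in each pair of component k, hence
  -- weight four, whereas `cover` makes such a word a union of pairs.
  by_contra hne
  have hS0 := (zmod_two_cases _).resolve_right hne
  have hvl : ∀ j r, δ l j r = 1 → v r = 0 := by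
    intro j r hr
    by_cases hj : j = 0
    · subst hj
      rw [hconst r hr, hS0]
    · exact hzero j hj r hr
  have hpt : ∀ i, ∃ q, δ k i q = 1 ∧ v q = 1 ∧ ∀ r, δ k i r = 1 → v r = 1 → r = q := by
    intro i
    have h := hodd i
    rw [hsum] at h
    rcases zmod_two_cases (v (S k i)) with h1 | h1
    · rw [h1, zero_add] at h
      refine ⟨T k i, hT1 k i, h, fun r hr hvr1 => ?_⟩
      rcases hall k i r hr with h2 | h2
      · rw [h2, h1] at hvr1
        exact absurd hvr1 (by decide)
      · exact h2
    · rw [h1] at h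
      have h2 := add_eq_left.1 h
      refine ⟨S k i, hS1 k i, h1, fun r hr hvr1 => ?_⟩
      rcases hall k i r hr with h3 | h3
      · exact h3
      · rw [h3, h2] at hvr1
        exact absurd hvr1 (by decide)
  choose q hq1 hq2 hq3 using hpt
  have hle : hammingNorm v ≤ 4 := by
    have hsub : (Finset.univ.filter fun r => v r ≠ 0) ⊆ Finset.univ.image q := by
      intro r hr
      have hr1 : v r = 1 := (zmod_two_cases _).resolve_left (Finset.mem_filter.1 hr).2
      obtain ⟨k', i, hki⟩ := component_cover hn hδ hdis r
      have hk : k' = k ∨ k' = l := by omega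
      rcases hk with rfl | rfl
      · exact Finset.mem_image.2 ⟨i, Finset.mem_univ i, (hq3 i r hki hr1).symm⟩
      · rw [hvl i r hki] at hr1
        exact absurd hr1 (by decide)
    exact (Finset.card_le_card hsub).trans (Finset.card_image_le.trans (by simp))
  have hv0 : v ≠ 0 := fun h => by
    have := hq2 0
    rw [h, Pi.zero_apply] at this
    exact absurd this (by decide)
  have hv4 : hammingNorm v = 4 := le_antisymm hle (hmin v hvD hv0)
  obtain ⟨j, hj, he⟩ := (hδ k).cover v hvD hv4 0 (q 0) (hq1 0) (hq2 0)
  have h := hodd 0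
  have hj0 : ∀ s, δ k 0 s = 1 → δ k j s = 0 := fun s hs => (hδ k).disj 0 j s hj.symm hs
  rw [hsum, he, Pi.add_apply, Pi.add_apply, hS1, hT1, hj0 _ (hS1 k 0), hj0 _ (hT1 k 0)] at h
  exact absurd h (by decide)

end Labelling

theorem isEquivalent_typeISixteen {n : ℕ} (hn : n = 16) {D : Code n} (hs : dual D = D)
    (hmin : ∀ x ∈ D, x ≠ 0 → 4 ≤ hammingNorm x)
    (h3 : ∀ p : Fin n, ((wordsOfWeight D 4).filter fun x => x p = 1).card = 3) :
    IsEquivalent D typeISixteen := by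
  obtain ⟨δ, hδ, hdis⟩ := exists_two_components hn hs hmin h3
  have hne : ∀ k : Fin 2, k ≠ k + 1 := by decide
  have hne' : ∀ k l : Fin 2, ¬ k = l → k = l + 1 := by decide
  choose v hvD hodd hv1 hv0 using fun k => exists_glue hn hs hmin hδ hdis (hne k)
  -- A coordinate is labelled by its component, its pair and the value there of the component's glue
  -- word, which separates the two points of the pair.
  have hpt : ∀ p : Idx, ∃ s, δ p.1 p.2.1 s = 1 ∧ v p.1 s = p.2.2 := by
    rintro ⟨k, i, a⟩
    obtain ⟨s, t, -, hs1, ht1, -, hsum⟩ := exists_points_of_weight_two ((hδ k).weight i)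
    have h := hodd k i
    rw [hsum] at h
    by_cases ha : v k s = a
    · exact ⟨s, hs1, ha⟩
    · refine ⟨t, ht1, ?_⟩
      revert h ha
      simp only
      generalize v k s = b
      generalize v k t = c
      revert a b c
      decide
  choose φ hφ1 hφ2 using hpt
  have hδφ : ∀ k i (p : Idx), δ k i (φ p) = if p.1 = k ∧ p.2.1 = i then 1 else 0 := by
    intro k i p
    split_ifs with h
    · obtain ⟨rfl, rfl⟩ := h
      exact hφ1 p
    · exact hdis p.1 p.2.1 k i _ (fun h' => h (Prod.ext_iff.1 h')) (hφ1 p)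
  have hinj : Function.Injective φ := by
    intro p q hpq
    have h1 := hφ1 q
    rw [← hpq, hδφ] at h1
    have h2 : p.1 = q.1 ∧ p.2.1 = q.2.1 := by
      by_contra hcon
      rw [if_neg hcon] at h1
      exact absurd h1 (by decide)
    have h3 := hφ2 q
    rw [← hpq, ← h2.1, hφ2] at h3
    exact Prod.ext h2.1 (Prod.ext h2.2 h3)
  have hbij : Function.Bijective φ :=
    (Fintype.bijective_iff_injective_and_card φ).2 ⟨hinj, by rw [Fintype.card_fin, hn]; decide⟩
  set f : Idx ≃ Fin n := Equiv.ofBijective φ hbij with hf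
  have hgen : ∀ g : Fin 2 × Fin 4, (gen g ∘ f.symm) ∈ D := by
    rintro ⟨k, i⟩
    have hw : ∀ w : Fin n → ZMod 2, (∀ p, w (φ p) = gen (k, i) p) → w ∈ D →
        (gen (k, i) ∘ f.symm) ∈ D := by
      intro w hw hwD
      have : gen (k, i) ∘ f.symm = w := by
        ext s
        obtain ⟨p, rfl⟩ := f.surjective s
        rw [Function.comp_apply, Equiv.symm_apply_apply]
        exact (hw p).symm
      rwa [this]
    by_cases hi : i = 0
    · refine hw (v k) (fun p => ?_) (hvD k)
      simp only [gen, hi, if_true]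
      split_ifs with h1 h2
      · rw [← h1, hφ2]
      · refine hv1 k _ ?_
        rw [hδφ, if_pos ⟨hne' _ _ h1, h2⟩]
      · refine hv0 k p.2.1 h2 _ ?_
        rw [hδφ, if_pos ⟨hne' _ _ h1, rfl⟩]
    · refine hw (δ k 0 + δ k i) (fun p => ?_) ((hδ k).add_mem 0 i)
      rw [Pi.add_apply, hδφ, hδφ]
      simp only [gen, hi, if_false]
      by_cases h1 : p.1 = k
      · by_cases h2 : p.2.1 = 0
        · have : ¬ (0 : Fin 4) = i := fun h => hi h.symm
          simp [h1, h2, this]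
        · simp [h1, h2]
      · simp [h1]
  refine ⟨f.symm.trans idxEquiv.symm, fun x => ⟨fun hx => ?_, fun hx => ?_⟩⟩
  · induction hx using Submodule.span_induction with
    | mem x hx =>
      obtain ⟨g, rfl⟩ := hx
      convert hgen g using 1
      ext s
      simp
    | zero => exact D.zero_mem
    | add x y _ _ hx hy => exact D.add_mem hx hy
    | smul a x _ hx => exact D.smul_mem a hx
  -- Self-duality of both codes turns the inclusion of generators into the reverse inclusion.
  · rw [← dual_typeISixteen]
    intro c hc
    have hc' : c ∘ (f.symm.trans idxEquiv.symm) ∈ D := by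
      induction hc using Submodule.span_induction with
      | mem x hx =>
        obtain ⟨g, rfl⟩ := hx
        convert hgen g using 1
        ext s
        simp
      | zero => exact D.zero_mem
      | add x y _ _ hx hy => exact D.add_mem hx hy
      | smul a x _ hx => exact D.smul_mem a hx
    rw [← hs] at hx
    have := hx _ hc'
    rw [← this]
    exact (Equiv.sum_comp (f.symm.trans idxEquiv.symm) fun i => c i * x i).symm

/-! ### The main theorem -/

theorem supp_one_add {n : ℕ} (x : Fin n → ZMod 2) : supp (1 + x) = (supp x)ᶜ := by
  ext i
  simp only [supp, Finset.mem_filter, Finset.mem_univ, true_and, Finset.mem_compl, Pi.add_apply,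
    Pi.one_apply]
  generalize x i = a
  revert a; decide

theorem blocks_compl {n : ℕ} {C : Code n} (h1 : (1 : Fin n → ZMod 2) ∈ C) {w : ℕ} (hw : w ≤ n) :
    blocks C (n - w) = (blocks C w).map fun b => bᶜ := by
  have h : wordsOfWeight C (n - w) = (wordsOfWeight C w).map (addLeftEmbedding 1) := by
    ext x
    simp only [Finset.mem_map, mem_wordsOfWeight, addLeftEmbedding_apply]
    have hx := hammingNorm_one_sub x
    constructor
    · rintro ⟨hxC, hxw⟩
      refine ⟨1 + x, ⟨C.add_mem h1 hxC, by omega⟩, ?_⟩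
      rw [← add_assoc, add_self_zmod_two, zero_add]
    · rintro ⟨y, ⟨hyC, hyw⟩, rfl⟩
      have hy := hammingNorm_one_sub y
      exact ⟨C.add_mem h1 hyC, by omega⟩
  rw [blocks, h, Finset.map_val, Multiset.map_map, blocks, Multiset.map_map]
  refine Multiset.map_congr rfl fun x _ => ?_
  exact supp_one_add x

section NearExtremal

variable {m : ℕ} {C : Code (8 * m)}

theorem two_mul_mem_properWeights (hm : 1 ≤ m) (hd : IsNearExtremal C) :
    2 * m ∈ properWeights C := by
  obtain ⟨x, hx, -, hw⟩ := hd.1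
  rw [Nat.mul_div_cancel_left m (by norm_num)] at hw
  exact ⟨by omega, by omega, x, hx, hw⟩

/-- All support designs are 1-designs, so a strict inequality would yield a 2-design at some weight,
and the transfer would make the minimum-weight words one. -/
theorem not_delta_lt_sMax (hm : m = 1 ∨ m = 3 ∨ m = 4) (hI : IsTypeI C) (hd : IsNearExtremal C)
    (hC : IsBalanced C) : ¬ delta C < sMax C := by
  have hm1 : 1 ≤ m := by omega
  have hne : (properWeights C).Nonempty := ⟨_, two_mul_mem_properWeights hm1 hd⟩
  have h1 : 1 ≤ delta C :=
    (delta_isGreatest C hne).2 fun w hw => isSupportDesign_one hm1 hI.1 hC hw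
  intro hlt
  obtain ⟨w, hw, l, hl⟩ := (sMax_isGreatest C hne).1
  obtain ⟨l', h2⟩ := hl.of_le (show 2 ≤ sMax C by omega)
  obtain ⟨hw0, hwn, x, hx, hxw⟩ := hw
  have hlow := hC.le_weight x hx fun h => by rw [h, hammingNorm_zero] at hxw; omega
  have hcompl := hammingNorm_one_sub x
  have hhigh := hC.le_weight (1 + x) (C.add_mem hC.one_mem hx) fun h => by
    rw [h, hammingNorm_zero] at hcompl
    omega
  have hcoeff := coeff_harmonicTwo_ne_zero hm (hxw ▸ hC.even x hx) (by omega)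
    (show w ≤ 6 * m by omega)
  exact not_isSupportDesign_min hm1 (by omega) hI hC
    (isSupportDesign_two_transfer hm1 hI.1 hC hcoeff ⟨l', h2⟩ (by omega) (by omega))

end NearExtremal

theorem isDesign_six {C : Code (8 * 2)} (hI : IsTypeI C) (hC : IsBalanced C) :
    IsDesign (blocks C 6) 2 (8 * 2) 6 8 := by
  obtain ⟨l, hl⟩ := isSupportDesign_two_of_coeff (by norm_num) hI.1 hC (w := 6) (by norm_num)
    (by norm_num) coeff_harmonicTwo_two.1
  have h := hl.card_two_mul
  -- The count 16 · 15 · l = 6 · 5 · 64 gives l = 8.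
  rw [card_blocks, card_two_six hI hC] at h
  have : l = 8 := by omega
  rwa [this] at hl

theorem delta_lt_sMax {C : Code (8 * 2)} (hI : IsTypeI C) (hd : IsNearExtremal C)
    (hC : IsBalanced C) : delta C < sMax C := by
  have h4 := two_mul_mem_properWeights (by norm_num) hd
  have hne : (properWeights C).Nonempty := ⟨_, h4⟩
  have h6 : 6 ∈ properWeights C := by
    obtain ⟨x, hx⟩ := Finset.card_pos.1 (by rw [card_two_six hI hC]; norm_num :
      0 < (wordsOfWeight C 6).card)
    obtain ⟨hx, hxw⟩ := mem_wordsOfWeight.1 hx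
    exact ⟨by norm_num, by norm_num, x, hx, hxw⟩
  have h2 : 2 ≤ sMax C := (sMax_isGreatest C hne).2 ⟨6, h6, 8, isDesign_six hI hC⟩
  refine lt_of_lt_of_le ?_ h2
  by_contra hcon
  obtain ⟨l, hl⟩ := (delta_isGreatest C hne).1 _ h4
  obtain ⟨l', hl'⟩ := hl.of_le (not_lt.1 hcon)
  exact not_isSupportDesign_min (by norm_num) (by norm_num) hI hC ⟨l', hl'⟩

theorem isEquivalent_of_isTypeI {C : Code (8 * 2)} (hI : IsTypeI C) (hC : IsBalanced C) :
    IsEquivalent C typeISixteen :=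
  isEquivalent_typeISixteen (by norm_num) hI.1 hC.le_weight (card_four_through hI hC)

end SupportDesign

open SupportDesign in
theorem theorem1p2 :
    -- (1), with `C₀` the unique Type I `[16, 8, 4]` code up to equivalence
    (∃ C₀ : Code 16, (IsTypeI C₀ ∧ HasParams C₀ 8 4) ∧
      (∀ D : Code 16, IsTypeI D → HasParams D 8 4 → IsEquivalent D C₀) ∧
      ∀ (n : ℕ) (C : Code n), n % 8 = 0 → IsTypeI C → IsNearExtremal C →
        (delta C < sMax C ↔ IsEquivalent C C₀) ∧
        (IsEquivalent C C₀ →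
          IsDesign (blocks C 6) 2 16 6 8 ∧
          blocks C 10 = (blocks C 6).map (fun b => bᶜ))) ∧
    -- (2); the union of two block collections is taken with multiplicities
    (∀ C : Code 16, IsEvenFormallySelfDual C → IsNearExtremal C →
      (∃ l, IsDesign (blocks C 6 + blocks (dual C) 6) 2 16 6 l) ∧
      (∃ l, IsDesign (blocks C 10 + blocks (dual C) 10) 2 16 10 l)) ∧
    -- (3)
    (∀ C : Code 64, IsEvenFormallySelfDual C → IsNearExtremal C →
      (∃ l, IsDesign (blocks C 28 + blocks (dual C) 28) 2 64 28 l) ∧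
      (∃ l, IsDesign (blocks C 36 + blocks (dual C) 36) 2 64 36 l)) := by
  refine ⟨⟨typeISixteen, ⟨isTypeI_typeISixteen, hasParams_typeISixteen⟩, ?_, ?_⟩, ?_, ?_⟩
  · intro D hI hP
    exact isEquivalent_of_isTypeI (C := D) hI
      (balanced_of_formallySelfDual (m := 2) (C := D) hI.isEvenFormallySelfDual hP.2).1
  · intro n C hn hI hd
    obtain ⟨m, rfl⟩ := Nat.dvd_of_mod_eq_zero hn
    have hC := (balanced_of_formallySelfDual hI.isEvenFormallySelfDual hd).1
    have hm0 : m ≠ 0 := by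
      -- In length zero the only weight is 0, so the code would be doubly even.
      rintro rfl
      refine hI.2 fun x _ => ?_
      have := hammingNorm_le x
      rw [Nat.le_zero.1 this]
      exact dvd_zero 4
    have hm4 : m ≤ 4 := by
      by_contra hcon
      exact not_isTypeI (by omega) hI hC
    by_cases hm2 : m = 2
    · subst hm2
      exact ⟨⟨fun _ => isEquivalent_of_isTypeI hI hC, fun _ => delta_lt_sMax hI hd hC⟩,
        fun _ => ⟨isDesign_six hI hC, blocks_compl hC.one_mem (w := 6) (by norm_num)⟩⟩
    · have hE : ¬ IsEquivalent C typeISixteen := by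
        rintro ⟨e, -⟩
        have := Fintype.card_congr e
        simp only [Fintype.card_fin] at this
        omega
      exact ⟨⟨fun h => absurd h (not_delta_lt_sMax (by omega) hI hd hC), fun h => absurd h hE⟩,
        fun h => absurd h hE⟩
  · intro C hF hd
    obtain ⟨hC, hD⟩ := balanced_of_formallySelfDual (m := 2) (C := C) hF hd
    exact ⟨isDesign_two_union (by norm_num) hC hD (by norm_num) (by norm_num)
      coeff_harmonicTwo_two.1, isDesign_two_union (by norm_num) hC hD (by norm_num) (by norm_num)
      coeff_harmonicTwo_two.2⟩
  · intro C hF hd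
    obtain ⟨hC, hD⟩ := balanced_of_formallySelfDual (m := 8) (C := C) hF hd
    exact ⟨isDesign_two_union (by norm_num) hC hD (by norm_num) (by norm_num)
      coeff_harmonicTwo_eight.1, isDesign_two_union (by norm_num) hC hD (by norm_num) (by norm_num)
      coeff_harmonicTwo_eight.2⟩
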